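/- Let $k\in\mathbb N$, let $\Sigma\in\mathbb R^{k\times k}$ be symmetric positive semidefinite, and let $G_1,G_2,\ldots$ be i.i.d. random vectors in $\mathbb R^k$ with law $\mathcal N(0,\Sigma)$, $G_i=(G_{i,1},\ldots,G_{i,k})$. Fix a real number $q>2$. Set $$M_q=\mathbb E|G|^q=\frac{2^{q/2}\,\Gamma\big((q+1)/2\big)}{\sqrt\pi},\qquad G\sim\mathcal N(0,1),$$ $$X_i=\big(|G_{i,1}|^q-\Sigma_{11}^{q/2}M_q,\ldots,|G_{i,k}|^q-\Sigma_{kk}^{q/2}M_q\big)\in\mathbb R^k,\qquad i\ge1.$$ Let $\Sigma^+$ be the Moore–Penrose pseudoinverse of $\Sigma$, where $x^\top\Sigma^+x:=+\infty$ if $x\notin\operatorname{range}(\Sigma)$. Let $\odot$ denote the componentwise product, let $z^{1/q}$ be the componentwise power, and let inequalities between vectors be componentwise. For $z,t\in[0,\infty)^k$ put $$\overline J(z)=\tfrac12\min_{\varepsilon\in\{-1,1\}^k}(\varepsilon\odot z^{1/q})^\top\Sigma^+(\varepsilon\odot z^{1/q})\in[0,\infty],\qquad J(t)=\inf_{s\ge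 t}\overline J(s).$$ Then for every $t\in(0,\infty)^k$ the minimum $$I_J(t)=\min\Big\{\sum_{r=1}^kJ\big(t^{(r)}\big):\ t^{(1)},\ldots,t^{(k)}\in[0,\infty)^k,\ \sum_{r=1}^kt^{(r)}=t\Big\}\in[0,\infty]$$ is attained, and $$\lim_{N\to\infty}\frac1{N^{2/q}}\log\mathbb P\Big(\frac1N\sum_{i=1}^NX_i\ge t\Big)=-I_J(t),$$ where $\log 0=-\infty$ and the limit is taken in $[-\infty,\infty]$. -/

import Mathlib

open MeasureTheory ProbabilityTheory Filter Topology Matrix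
open scoped ENNReal

namespace AbsPowersGauss

/-- `B` is a Moore-Penrose pseudoinverse of the real square matrix `A`:
the four Penrose equations hold. -/
structure IsMoorePenrose {k : ℕ} (A B : Matrix (Fin k) (Fin k) ℝ) : Prop where
  mul_mul_self : A * B * A = A
  self_mul_mul : B * A * B = B
  symm_left : (A * B)ᵀ = A * B
  symm_right : (B * A)ᵀ = B * A

theorem IsMoorePenrose.unique {k : ℕ} {A B C : Matrix (Fin k) (Fin k) ℝ}
    (hB : IsMoorePenrose A B) (hC : IsMoorePenrose A C) : B = C := by
  have h1 : A * B = A * C := by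
    calc A * B = (A * B)ᵀ := hB.symm_left.symm
      _ = (A * C * (A * B))ᵀ := by rw [← Matrix.mul_assoc, hC.mul_mul_self]
      _ = A * B * (A * C) := by rw [Matrix.transpose_mul, hB.symm_left, hC.symm_left]
      _ = A * C := by rw [← Matrix.mul_assoc, hB.mul_mul_self]
  have h2 : B * A = C * A := by
    calc B * A = (B * A)ᵀ := hB.symm_right.symm
      _ = (B * A * (C * A))ᵀ := by
        rw [Matrix.mul_assoc, ← Matrix.mul_assoc A, hC.mul_mul_self]
      _ = C * A * (B * A) := by rw [Matrix.transpose_mul, hB.symm_right, hC.symm_right]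
      _ = C * A := by rw [Matrix.mul_assoc, ← Matrix.mul_assoc A, hB.mul_mul_self]
  calc B = B * A * B := hB.self_mul_mul.symm
    _ = C * A * C := by rw [h2, Matrix.mul_assoc, h1, ← Matrix.mul_assoc]
    _ = C := hC.self_mul_mul

theorem exists_isMoorePenrose {k : ℕ} {A : Matrix (Fin k) (Fin k) ℝ} (hA : A.IsHermitian) :
    ∃ B, IsMoorePenrose A B := by
  obtain ⟨U, d, hU, hAd⟩ : ∃ (U : Matrix (Fin k) (Fin k) ℝ) (d : Fin k → ℝ),
      Uᵀ * U = 1 ∧ A = U * diagonal d * Uᵀ := by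
    refine ⟨hA.eigenvectorUnitary, hA.eigenvalues, ?_, ?_⟩
    · simpa [Matrix.star_eq_conjTranspose] using
        (Matrix.mem_unitaryGroup_iff'.1 hA.eigenvectorUnitary.2)
    · simpa [Unitary.conjStarAlgAut_apply, Matrix.star_eq_conjTranspose, Function.comp_def]
        using hA.spectral_theorem
  have key : ∀ a b : Fin k → ℝ, U * diagonal a * Uᵀ * (U * diagonal b * Uᵀ) =
      U * diagonal (fun i => a i * b i) * Uᵀ := by
    intro a b
    calc U * diagonal a * Uᵀ * (U * diagonal b * Uᵀ)
        = U * diagonal a * (Uᵀ * U) * diagonal b * Uᵀ := by simp only [Matrix.mul_assoc]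
      _ = _ := by rw [hU, Matrix.mul_one, Matrix.mul_assoc U, diagonal_mul_diagonal]
  have ht : ∀ a : Fin k → ℝ, (U * diagonal a * Uᵀ)ᵀ = U * diagonal a * Uᵀ := by
    intro a
    simp [Matrix.transpose_mul, Matrix.mul_assoc]
  have e : ∀ a : ℝ, a⁻¹ * a * a⁻¹ = a⁻¹ := fun a => by simpa using mul_inv_mul_cancel a⁻¹
  refine ⟨U * diagonal (fun i => (d i)⁻¹) * Uᵀ, ?_, ?_, ?_, ?_⟩ <;>
    simp only [hAd, key, ht, mul_inv_mul_cancel, e]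

open Classical in
/-- The Moore-Penrose pseudoinverse `A⁺` of a symmetric matrix `A`
(with the irrelevant value `0` if there is none). -/
noncomputable def pinv {k : ℕ} (A : Matrix (Fin k) (Fin k) ℝ) : Matrix (Fin k) (Fin k) ℝ :=
  if h : ∃ B, IsMoorePenrose A B then h.choose else 0

theorem isMoorePenrose_pinv {k : ℕ} {A : Matrix (Fin k) (Fin k) ℝ} (hA : A.IsHermitian) :
    IsMoorePenrose A (pinv A) := by
  have h := exists_isMoorePenrose hA
  rw [pinv, dif_pos h]
  exact h.choose_spec

theorem pinv_form_nonneg {k : ℕ} {A : Matrix (Fin k) (Fin k) ℝ} (hA : A.PosSemidef)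
    (x : Fin k → ℝ) : 0 ≤ x ⬝ᵥ (pinv A *ᵥ x) := by
  have h := isMoorePenrose_pinv hA.isHermitian
  have hAt : Aᵀ = A := by simpa using hA.isHermitian.eq
  have hs : (pinv A)ᵀ = pinv A := by
    refine IsMoorePenrose.unique (A := A) ⟨?_, ?_, ?_, ?_⟩ h
    · simpa [Matrix.transpose_mul, hAt, Matrix.mul_assoc] using
        congrArg Matrix.transpose h.mul_mul_self
    · simpa [Matrix.transpose_mul, hAt, Matrix.mul_assoc] using
        congrArg Matrix.transpose h.self_mul_mul
    · have := h.symm_right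
      rw [Matrix.transpose_mul, hAt] at this
      rw [this, Matrix.transpose_mul, hAt]; exact this
    · have := h.symm_left
      rw [Matrix.transpose_mul, hAt] at this
      rw [this, Matrix.transpose_mul, hAt]; exact this
  have h0 := hA.dotProduct_mulVec_nonneg (pinv A *ᵥ x)
  have e : x ⬝ᵥ (pinv A *ᵥ x) = (pinv A *ᵥ x) ⬝ᵥ (A *ᵥ (pinv A *ᵥ x)) := by
    conv_lhs => rw [← h.self_mul_mul, Matrix.mul_assoc, ← Matrix.mulVec_mulVec,
      Matrix.dotProduct_mulVec, ← Matrix.mulVec_transpose, hs, ← Matrix.mulVec_mulVec]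
  rw [e]
  simpa using h0

open Classical in
/-- The quadratic form `xᵀ A⁺ x` of a positive semidefinite matrix `A`, with the value `+∞` if `x`
is not in the range of `A`. (The form is nonnegative, so `ENNReal.ofReal` truncates nothing.) -/
noncomputable def pinvForm {k : ℕ} (A : Matrix (Fin k) (Fin k) ℝ) (x : Fin k → ℝ) : ℝ≥0∞ :=
  if x ∈ Set.range (fun y : Fin k → ℝ => A *ᵥ y) then ENNReal.ofReal (x ⬝ᵥ (pinv A *ᵥ x)) else ⊤

/-- `J̄(z) = ½ min_{ε ∈ {-1,1}^k} (ε ⊙ z^{1/q})ᵀ S⁺ (ε ⊙ z^{1/q})` for `z ∈ [0,∞)^k`. -/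
noncomputable def Jbar {k : ℕ} (S : Matrix (Fin k) (Fin k) ℝ) (q : ℝ) (z : Fin k → ℝ) : ℝ≥0∞ :=
  2⁻¹ * ⨅ ε : Fin k → ℤˣ, pinvForm S (fun j => ((ε j : ℤ) : ℝ) * z j ^ (1 / q))

/-- `J(t) = inf_{s ≥ t} J̄(s)` for `t ∈ [0,∞)^k`, with the componentwise order. -/
noncomputable def tailRate {k : ℕ} (S : Matrix (Fin k) (Fin k) ℝ) (q : ℝ) (t : Fin k → ℝ) : ℝ≥0∞ :=
  ⨅ (s : Fin k → ℝ) (_ : t ≤ s), Jbar S q s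

/-- The set of all sums `∑_{r=1}^k F(t^{(r)})` over the decompositions
`t = t^{(1)} + ⋯ + t^{(k)}` with `t^{(r)} ∈ [0,∞)^k`. -/
def decompositionCosts {k : ℕ} (F : (Fin k → ℝ) → ℝ≥0∞) (t : Fin k → ℝ) : Set ℝ≥0∞ :=
  {c | ∃ u : Fin k → Fin k → ℝ, (∀ r, 0 ≤ u r) ∧ ∑ r, u r = t ∧ c = ∑ r, F (u r)}

/-- The rate function `I_F(t)`, the infimum of the decomposition costs of `t`. -/
noncomputable def rateI {k : ℕ} (F : (Fin k → ℝ) → ℝ≥0∞) (t : Fin k → ℝ) : ℝ≥0∞ :=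
  sInf (decompositionCosts F t)

/-- `M_q = E|G|^q` for a standard Gaussian `G`. -/
noncomputable def absMoment (q : ℝ) : ℝ := ∫ x, |x| ^ q ∂(gaussianReal 0 1)

/-- The vector `(|g_j|^q - S_jj^{q/2} M_q)_j`. -/
noncomputable def centeredPower {k : ℕ} (S : Matrix (Fin k) (Fin k) ℝ) (q : ℝ)
    (g : EuclideanSpace ℝ (Fin k)) (j : Fin k) : ℝ :=
  |g j| ^ q - S j j ^ (q / 2) * absMoment q

end AbsPowersGauss

open AbsPowersGauss

/-!
Write `S = A²` with `A` symmetric and `T` for the operator of `A`. Up to a null set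
`G_i = T Z_i`, where the `Z_i` are i.i.d. and `‖Z_i‖` is dominated in law by the norm of a standard
Gaussian vector. The summands `|G_{i,j}|^q` have stretched exponential tails of order `2 / q < 1`,
so a deviation of order `N` is produced most cheaply by finitely many vectors `Z_i = N^{1/q} w_i`
(the jumps), at the price `N^{2/q} ∑ ‖w_i‖² / 2`, while all the others behave typically.

*The rate.* `xᵀ S⁺ x` is the least squared norm of a preimage of `x` under `A`, so `I_J(t)` is the
least cost `jumpRate` of `k` jumps whose total effect `∑_r (|(T w_r)_j|^q)_j` is at least `t`
(`rateI_eq_jumpRate`). In this form the minimum is the distance of a closed set to the origin and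
thus attained (`exists_eq_jumpRate`). More than `k` jumps are of no help: the cost is concave along
rays, so a linear relation between the effects of the jumps allows one of them to be removed
(`exists_card_le_sum_absPow_eq`).

*Upper bound* (`eventually_measureReal_le_exp`). Call `Z_i` small if `‖Z_i‖ ≤ δ N^{1/q}`. For small
`δ`, the exponential Chebyshev inequality with parameter of order `N^{2/q - 1}` shows that the small
vectors stay near their mean, up to probabilities that are negligible on the scale `N^{2/q}`
(`eventually_measureReal_truncated_le`). Otherwise the large vectors have total effect at least
`σ N t` with `σ` close to `1`, and by the definition of the rate and its homogeneity their energy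
`∑ ‖Z_i‖² / 2` is at least `(σ N)^{2/q} I_J(t)`. Large vectors are so rare that the exponential
moments of this energy, of every order below `1`, stay bounded in `N`
(`exists_eventually_measureReal_large_le`), which gives the claim without any counting of the
jumps.

*Lower bound* (`exists_eventually_le_measureReal`). Let the first `k` vectors be near
`c N^{1/q} w_r` for an optimal family `w` and `c > 1`, and let the remaining ones obey the law of
large numbers.
-/

namespace AbsPowersGauss

/-! ### Powers of the coordinates and the cost of a family of jumps -/

/-- The vector `(|(T z)_j|^q)_j` of the absolute powers of the coordinates of `T z`. -/
noncomputable def absPow {k : ℕ} (T : EuclideanSpace ℝ (Fin k) →L[ℝ] EuclideanSpace ℝ (Fin k))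
    (q : ℝ) (z : EuclideanSpace ℝ (Fin k)) : Fin k → ℝ :=
  fun j => |T z j| ^ q

section absPow

variable {k : ℕ} {T : EuclideanSpace ℝ (Fin k) →L[ℝ] EuclideanSpace ℝ (Fin k)} {q : ℝ}

theorem absPow_nonneg (z : EuclideanSpace ℝ (Fin k)) (j : Fin k) : 0 ≤ absPow T q z j :=
  Real.rpow_nonneg (abs_nonneg _) _

theorem absPow_smul {c : ℝ} (hc : 0 ≤ c) (z : EuclideanSpace ℝ (Fin k)) (j : Fin k) :
    absPow T q (c • z) j = c ^ q * absPow T q z j := by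
  simp [absPow, abs_mul, abs_of_nonneg hc, Real.mul_rpow hc (abs_nonneg _)]

theorem absPow_zero (hq : 0 < q) (j : Fin k) : absPow T q 0 j = 0 := by
  simp [absPow, Real.zero_rpow hq.ne']

theorem continuous_absPow (hq : 0 < q) (j : Fin k) : Continuous fun z => absPow T q z j := by
  unfold absPow
  exact Continuous.rpow_const (by fun_prop) fun _ => Or.inr hq.le

theorem absPow_le (hq : 0 < q) (z : EuclideanSpace ℝ (Fin k)) (j : Fin k) :
    absPow T q z j ≤ ‖T‖ ^ q * ‖z‖ ^ q := by
  rw [← Real.mul_rpow (norm_nonneg _) (norm_nonneg _)]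
  refine Real.rpow_le_rpow (abs_nonneg _) ?_ hq.le
  calc |T z j| = ‖T z j‖ := rfl
    _ ≤ ‖T z‖ := PiLp.norm_apply_le _ _
    _ ≤ _ := T.le_opNorm z

end absPow

/-- Carathéodory-type reduction: since the cost `‖w‖²` is concave (of degree `2 / q < 1`) along the
rays of the vectors `absPow T q w`, a family of jumps can be replaced by at most `k` jumps with
the same total effect and no larger cost. -/
theorem exists_card_le_sum_absPow_eq {k : ℕ}
    (T : EuclideanSpace ℝ (Fin k) →L[ℝ] EuclideanSpace ℝ (Fin k)) {q : ℝ} (hq : 2 < q)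
    {ι : Type*} (B : Finset ι) (w : ι → EuclideanSpace ℝ (Fin k)) :
    ∃ (B' : Finset ι) (w' : ι → EuclideanSpace ℝ (Fin k)), B'.card ≤ k ∧
      (∀ j, ∑ i ∈ B', absPow T q (w' i) j = ∑ i ∈ B, absPow T q (w i) j) ∧
      ∑ i ∈ B', ‖w' i‖ ^ 2 ≤ ∑ i ∈ B, ‖w i‖ ^ 2 := by
  classical
  have hq0 : 0 < q := by linarith
  induction hn : B.card using Nat.strong_induction_on generalizing B w with
  | _ n ih =>
  by_cases hk : B.card ≤ k
  · exact ⟨B, w, hk, fun _ => rfl, le_rfl⟩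
  -- it is enough to remove one jump
  suffices h : ∃ i₁ ∈ B, ∃ w₁ : ι → EuclideanSpace ℝ (Fin k),
      (∀ j, ∑ i ∈ B.erase i₁, absPow T q (w₁ i) j = ∑ i ∈ B, absPow T q (w i) j) ∧
      ∑ i ∈ B.erase i₁, ‖w₁ i‖ ^ 2 ≤ ∑ i ∈ B, ‖w i‖ ^ 2 by
    obtain ⟨i₁, hi₁, w₁, h1, h2⟩ := h
    obtain ⟨B', w', h3, h4, h5⟩ :=
      ih _ (hn ▸ Finset.card_erase_lt_of_mem hi₁) (B.erase i₁) w₁ rfl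
    exact ⟨B', w', h3, fun j => (h4 j).trans (h1 j), h5.trans h2⟩
  obtain ⟨a, ha, i₀, hi₀, hai₀⟩ : ∃ a : ι → ℝ,
      ∑ i ∈ B, a i • absPow T q (w i) = 0 ∧ ∃ i₀ ∈ B, a i₀ ≠ 0 := by
    by_contra! hcon
    have hli : LinearIndepOn ℝ (fun i => absPow T q (w i)) (B : Set ι) :=
      linearIndepOn_finset_iff.2 hcon
    have := LinearIndependent.fintype_card_le_finrank (R := ℝ) hli
    simp at this
    omega
  wlog hs : ∑ i ∈ B, a i * ‖w i‖ ^ 2 ≤ 0 generalizing a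
  · refine this (-a) ?_ (by simpa using hai₀) ?_
    · simp [Finset.sum_neg_distrib, ha]
    · simp only [Pi.neg_apply, neg_mul, Finset.sum_neg_distrib]
      linarith
  have haj : ∀ j, ∑ i ∈ B, a i * absPow T q (w i) j = 0 := fun j => by
    simpa using congrFun ha j
  by_cases hneg : ∃ i ∈ B, a i < 0
  · -- rescale the jumps linearly in `a` until the first one vanishes
    obtain ⟨i₂, hi₂, hai₂⟩ := hneg
    obtain ⟨i₁, hi₁, hmin⟩ := Finset.exists_min_image B a ⟨i₂, hi₂⟩
    have hb : 0 < -a i₁ := by linarith [hmin i₂ hi₂]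
    set b := -a i₁ with hbdef
    have hc : ∀ i ∈ B, -1 ≤ a i / b := fun i hi => by
      rw [le_div_iff₀ hb]; linarith [hmin i hi]
    have hz : 1 + a i₁ / b = 0 := by
      have : a i₁ = -b := by simp [hbdef]
      rw [this, neg_div, div_self hb.ne']; ring
    refine ⟨i₁, hi₁, fun i => ((1 + a i / b) ^ (1 / q)) • w i, fun j => ?_, ?_⟩
    · have e : ∀ i ∈ B, absPow T q (((1 + a i / b) ^ (1 / q)) • w i) j =
          absPow T q (w i) j + b⁻¹ * (a i * absPow T q (w i) j) := fun i hi => by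
        have h0 : 0 ≤ 1 + a i / b := by linarith [hc i hi]
        rw [absPow_smul (Real.rpow_nonneg h0 _), ← Real.rpow_mul h0, one_div_mul_cancel hq0.ne',
          Real.rpow_one]
        ring
      rw [Finset.sum_erase, Finset.sum_congr rfl e, Finset.sum_add_distrib, ← Finset.mul_sum, haj]
      · ring
      · simp [hz, Real.zero_rpow (inv_ne_zero hq0.ne'), absPow_zero hq0]
    · calc ∑ i ∈ B.erase i₁, ‖((1 + a i / b) ^ (1 / q)) • w i‖ ^ 2
          ≤ ∑ i ∈ B, ‖((1 + a i / b) ^ (1 / q)) • w i‖ ^ 2 :=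
            Finset.sum_le_sum_of_subset_of_nonneg (Finset.erase_subset _ _)
              fun _ _ _ => sq_nonneg _
        _ ≤ ∑ i ∈ B, (‖w i‖ ^ 2 + 2 / q * b⁻¹ * (a i * ‖w i‖ ^ 2)) := by
            refine Finset.sum_le_sum fun i hi => ?_
            have h0 : 0 ≤ 1 + a i / b := by linarith [hc i hi]
            have h1 := rpow_one_add_le_one_add_mul_self (hc i hi) (p := 2 / q) (by positivity)
              (by rw [div_le_one hq0]; exact hq.le)
            have h2 : ((1 + a i / b) ^ (1 / q)) ^ 2 = (1 + a i / b) ^ (2 / q) := by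
              rw [← Real.rpow_natCast, ← Real.rpow_mul h0]
              congr 1; push_cast; ring
            rw [norm_smul, mul_pow, Real.norm_eq_abs, sq_abs, h2]
            calc _ ≤ (1 + 2 / q * (a i / b)) * ‖w i‖ ^ 2 :=
                  mul_le_mul_of_nonneg_right h1 (sq_nonneg _)
              _ = _ := by rw [div_eq_mul_inv (a i)]; ring
        _ ≤ ∑ i ∈ B, ‖w i‖ ^ 2 := by
            rw [Finset.sum_add_distrib, ← Finset.mul_sum]
            have : 0 ≤ 2 / q * b⁻¹ := by positivity
            nlinarith
  · -- a nonnegative relation between nonnegative vectors: the jump `i₀` has no effect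
    push Not at hneg
    refine ⟨i₀, hi₀, w, fun j => Finset.sum_erase _ ?_,
      Finset.sum_le_sum_of_subset_of_nonneg (Finset.erase_subset _ _) fun _ _ _ => sq_nonneg _⟩
    have := (Finset.sum_eq_zero_iff_of_nonneg fun i hi =>
      mul_nonneg (hneg i hi) (absPow_nonneg (w i) j)).1 (haj j) i₀ hi₀
    exact (mul_eq_zero.1 this).resolve_left hai₀

/-- The least cost `∑_r ‖w_r‖² / 2` of `k` jumps `w_1, …, w_k` whose total effect
`∑_r (|(T w_r)_j|^q)_j` is at least `t`. -/
noncomputable def jumpRate {k : ℕ}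
    (T : EuclideanSpace ℝ (Fin k) →L[ℝ] EuclideanSpace ℝ (Fin k)) (q : ℝ) (t : Fin k → ℝ) : ℝ≥0∞ :=
  ⨅ (w : Fin k → EuclideanSpace ℝ (Fin k)) (_ : ∀ j, t j ≤ ∑ r, absPow T q (w r) j),
    ENNReal.ofReal (∑ r, ‖w r‖ ^ 2 / 2)

section jumpRate

variable {k : ℕ} {T : EuclideanSpace ℝ (Fin k) →L[ℝ] EuclideanSpace ℝ (Fin k)} {q : ℝ}
  {t : Fin k → ℝ}

theorem jumpRate_le (w : Fin k → EuclideanSpace ℝ (Fin k))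
    (hw : ∀ j, t j ≤ ∑ r, absPow T q (w r) j) :
    jumpRate T q t ≤ ENNReal.ofReal (∑ r, ‖w r‖ ^ 2 / 2) :=
  iInf₂_le w hw

/-- Allowing more than `k` jumps does not lower the cost. -/
theorem jumpRate_le_of_finset (hq : 2 < q) {ι : Type*} (B : Finset ι)
    (w : ι → EuclideanSpace ℝ (Fin k)) (hw : ∀ j, t j ≤ ∑ i ∈ B, absPow T q (w i) j) :
    jumpRate T q t ≤ ENNReal.ofReal (∑ i ∈ B, ‖w i‖ ^ 2 / 2) := by
  classical
  obtain ⟨B', w', hB', he, hc⟩ := exists_card_le_sum_absPow_eq T hq B w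
  obtain ⟨e⟩ : Nonempty (B' ↪ Fin k) :=
    Function.Embedding.nonempty_of_card_le (by simpa using hB')
  set v : Fin k → EuclideanSpace ℝ (Fin k) := Function.extend e (fun i => w' i) 0 with hv
  have key : ∀ f : EuclideanSpace ℝ (Fin k) → ℝ, f 0 = 0 → ∑ r, f (v r) = ∑ i ∈ B', f (w' i) := by
    intro f hf
    rw [← Finset.sum_coe_sort B', ← Finset.sum_subset (Finset.subset_univ (Finset.univ.map e)),
      Finset.sum_map]
    · simp [hv, e.injective.extend_apply]
    · intro r _ hr
      rw [hv, Function.extend_apply', Pi.zero_apply, hf]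
      rintro ⟨i, hi⟩
      exact hr (by simp [← hi])
  refine (jumpRate_le v fun j => ?_).trans (ENNReal.ofReal_le_ofReal ?_)
  · rw [key (fun z => absPow T q z j) (absPow_zero (by linarith) j), he]
    exact hw j
  · rw [key (fun z => ‖z‖ ^ 2 / 2) (by simp), ← Finset.sum_div, ← Finset.sum_div]
    linarith

/-- The cost is homogeneous of degree `2 / q`: a lower bound for the cost of jumps whose total
effect is at least `a t`. -/
theorem rpow_mul_le_sum_of_le_jumpRate (hq : 2 < q) {ι : Type*} (B : Finset ι)
    (w : ι → EuclideanSpace ℝ (Fin k)) {a l : ℝ} (ha : 0 < a)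
    (hl : ENNReal.ofReal l ≤ jumpRate T q t)
    (hw : ∀ j, a * t j ≤ ∑ i ∈ B, absPow T q (w i) j) :
    a ^ (2 / q) * l ≤ ∑ i ∈ B, ‖w i‖ ^ 2 / 2 := by
  have hq0 : 0 < q := by linarith
  have h0 : 0 ≤ a⁻¹ := (inv_pos.2 ha).le
  have h1 := hl.trans (jumpRate_le_of_finset hq B (fun i => (a⁻¹ ^ (1 / q)) • w i) fun j => by
    simp_rw [absPow_smul (Real.rpow_nonneg h0 _), ← Real.rpow_mul h0, one_div_mul_cancel hq0.ne',
      Real.rpow_one, ← Finset.mul_sum]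
    rw [inv_mul_eq_div, le_div_iff₀ ha, mul_comm]
    exact hw j)
  have h2 : ∑ i ∈ B, ‖(a⁻¹ ^ (1 / q)) • w i‖ ^ 2 / 2 =
      (a ^ (2 / q))⁻¹ * ∑ i ∈ B, ‖w i‖ ^ 2 / 2 := by
    rw [Finset.mul_sum]
    refine Finset.sum_congr rfl fun i _ => ?_
    have h3 : (a⁻¹ ^ (1 / q)) ^ 2 = (a ^ (2 / q))⁻¹ := by
      rw [← Real.rpow_natCast, ← Real.rpow_mul h0, ← Real.inv_rpow ha.le]
      congr 1; push_cast; ring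
    rw [norm_smul, mul_pow, Real.norm_eq_abs, sq_abs, h3]
    ring
  have h4 : 0 < a ^ (2 / q) := Real.rpow_pos_of_pos ha _
  rw [h2, ENNReal.ofReal_le_ofReal_iff (by positivity), inv_mul_eq_div, le_div_iff₀ h4] at h1
  linarith

/-- The minimum defining `jumpRate` is attained: the admissible families form a closed subset
of a Euclidean space, so one of them has the least norm. -/
theorem exists_eq_jumpRate (hq : 2 < q) (ht : jumpRate T q t ≠ ⊤) :
    ∃ w : Fin k → EuclideanSpace ℝ (Fin k), (∀ j, t j ≤ ∑ r, absPow T q (w r) j) ∧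
      jumpRate T q t = ENNReal.ofReal (∑ r, ‖w r‖ ^ 2 / 2) := by
  set C : Set (PiLp 2 fun _ : Fin k => EuclideanSpace ℝ (Fin k)) :=
    {x | ∀ j, t j ≤ ∑ r, absPow T q (x r) j} with hC
  have hcl : IsClosed C := by
    have : C = ⋂ j, {x | t j ≤ ∑ r, absPow T q (x r) j} := by ext; simp [hC]
    rw [this]
    refine isClosed_iInter fun j => isClosed_le continuous_const
      (continuous_finsetSum _ fun r _ => ?_)
    exact (continuous_absPow (by linarith) j).comp (by fun_prop)
  have hne : C.Nonempty := by
    by_contra hcon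
    refine ht (iInf₂_eq_top.2 fun w hw => (hcon ⟨WithLp.toLp 2 w, ?_⟩).elim)
    simpa [hC] using hw
  obtain ⟨x, hx, hd⟩ := hcl.exists_infDist_eq_dist hne 0
  refine ⟨fun r => x r, hx, le_antisymm (jumpRate_le _ hx) (le_iInf₂ fun w hw =>
    ENNReal.ofReal_le_ofReal ?_)⟩
  have hw' : WithLp.toLp 2 w ∈ C := by simpa [hC] using hw
  have h1 : ‖x‖ ≤ ‖WithLp.toLp 2 w‖ := by
    simpa [hd] using Metric.infDist_le_dist_of_mem (x := 0) hw'
  have h2 := pow_le_pow_left₀ (norm_nonneg _) h1 2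
  rw [PiLp.norm_sq_eq_of_L2, PiLp.norm_sq_eq_of_L2] at h2
  rw [← Finset.sum_div, ← Finset.sum_div]
  exact div_le_div_of_nonneg_right h2 zero_le_two

end jumpRate

/-! ### The pseudoinverse and the rate function -/

section Pinv

variable {k : ℕ} {S A : Matrix (Fin k) (Fin k) ℝ}

theorem transpose_pinv (hS : S.IsHermitian) : (pinv S)ᵀ = pinv S := by
  have h := isMoorePenrose_pinv hS
  have hSt : Sᵀ = S := by simpa using hS.eq
  refine IsMoorePenrose.unique (A := S) ⟨?_, ?_, ?_, ?_⟩ h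
  · simpa [Matrix.transpose_mul, hSt, Matrix.mul_assoc] using
      congrArg Matrix.transpose h.mul_mul_self
  · simpa [Matrix.transpose_mul, hSt, Matrix.mul_assoc] using
      congrArg Matrix.transpose h.self_mul_mul
  · have := h.symm_right
    rw [Matrix.transpose_mul, hSt] at this
    rw [this, Matrix.transpose_mul, hSt]; exact this
  · have := h.symm_left
    rw [Matrix.transpose_mul, hSt] at this
    rw [this, Matrix.transpose_mul, hSt]; exact this

/-- A symmetric square root of `S` has the same range as `S`, and `S S⁺` is the orthogonal
projection onto it. -/
theorem mul_pinv_mul_sqrt (hS : S.IsHermitian) (hA : Aᵀ = A) (hAS : A * A = S) :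
    S * pinv S * A = A := by
  have h := isMoorePenrose_pinv hS
  set D := S * pinv S * A - A with hD
  have hDt : Dᵀ = A * (S * pinv S) - A := by
    rw [hD, Matrix.transpose_sub, Matrix.transpose_mul, h.symm_left, hA]
  have : D * Dᴴ = 0 := by
    rw [Matrix.conjTranspose_eq_transpose_of_trivial, hDt, hD]
    calc (S * pinv S * A - A) * (A * (S * pinv S) - A)
        = (S * pinv S * (A * A) - A * A) * (S * pinv S) - (S * pinv S * (A * A) - A * A) := by
          noncomm_ring
      _ = 0 := by rw [hAS, h.mul_mul_self]; simp
  exact sub_eq_zero.1 (Matrix.self_mul_conjTranspose_eq_zero.1 this)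

/-- `A S⁺ A`, for a symmetric square root `A` of `S`, is idempotent. -/
theorem sqrt_mul_pinv_mul_sqrt_sq (hS : S.IsHermitian) (hAS : A * A = S) :
    A * pinv S * A * (A * pinv S * A) = A * pinv S * A := by
  have h := isMoorePenrose_pinv hS
  calc A * pinv S * A * (A * pinv S * A) = A * (pinv S * (A * A) * pinv S) * A := by
        simp only [Matrix.mul_assoc]
    _ = _ := by rw [hAS, h.self_mul_mul]

/-- `A S⁺ A` is an orthogonal projection, hence at most the identity. -/
theorem dotProduct_sqrt_mul_pinv_mul_sqrt_le (hS : S.IsHermitian) (hA : Aᵀ = A) (hAS : A * A = S)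
    (x : Fin k → ℝ) : x ⬝ᵥ ((A * pinv S * A) *ᵥ x) ≤ x ⬝ᵥ x := by
  set E := A * pinv S * A with hE
  have hEt : Eᵀ = E := by
    simp [hE, Matrix.transpose_mul, hA, transpose_pinv hS, Matrix.mul_assoc]
  have h1 : (E *ᵥ x) ⬝ᵥ (E *ᵥ x) = x ⬝ᵥ (E *ᵥ x) := by
    rw [Matrix.dotProduct_mulVec, ← Matrix.mulVec_transpose, hEt, Matrix.mulVec_mulVec,
      sqrt_mul_pinv_mul_sqrt_sq hS hAS, dotProduct_comm]
  have h2 : 0 ≤ (x - E *ᵥ x) ⬝ᵥ (x - E *ᵥ x) := Finset.sum_nonneg fun i _ => mul_self_nonneg _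
  rw [sub_dotProduct, dotProduct_sub, dotProduct_sub, h1, dotProduct_comm (E *ᵥ x) x] at h2
  linarith

theorem norm_sq_eq_dotProduct (w : EuclideanSpace ℝ (Fin k)) : ‖w‖ ^ 2 = (w : Fin k → ℝ) ⬝ᵥ w := by
  rw [EuclideanSpace.real_norm_sq_eq]
  simp [dotProduct, pow_two]

theorem toEuclideanCLM_apply (A : Matrix (Fin k) (Fin k) ℝ) (w : EuclideanSpace ℝ (Fin k)) :
    (toEuclideanCLM (𝕜 := ℝ) A w : Fin k → ℝ) = A *ᵥ w := rfl

theorem norm_toEuclideanCLM_projection_le (hS : S.IsHermitian) (hA : Aᵀ = A) (hAS : A * A = S)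
    (z : EuclideanSpace ℝ (Fin k)) :
    ‖toEuclideanCLM (𝕜 := ℝ) (A * pinv S * A) z‖ ≤ ‖z‖ := by
  refine le_of_sq_le_sq ?_ (norm_nonneg _)
  rw [norm_sq_eq_dotProduct, norm_sq_eq_dotProduct, toEuclideanCLM_apply]
  refine le_trans (le_of_eq ?_) (dotProduct_sqrt_mul_pinv_mul_sqrt_le hS hA hAS _)
  have ht : (A * pinv S * A)ᵀ = A * pinv S * A := by
    simp [Matrix.transpose_mul, hA, transpose_pinv hS, Matrix.mul_assoc]
  rw [Matrix.dotProduct_mulVec, ← Matrix.mulVec_transpose, ht, Matrix.mulVec_mulVec,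
    sqrt_mul_pinv_mul_sqrt_sq hS hAS, dotProduct_comm]

/-- The form `xᵀ S⁺ x` is at most the squared norm of any preimage of `x` under `A`. -/
theorem pinvForm_le (hS : S.IsHermitian) (hA : Aᵀ = A) (hAS : A * A = S)
    (w : EuclideanSpace ℝ (Fin k)) :
    pinvForm S (toEuclideanCLM (𝕜 := ℝ) A w) ≤ ENNReal.ofReal (‖w‖ ^ 2) := by
  rw [toEuclideanCLM_apply, pinvForm, if_pos]
  · refine ENNReal.ofReal_le_ofReal ?_
    rw [norm_sq_eq_dotProduct]
    refine le_trans (le_of_eq ?_) (dotProduct_sqrt_mul_pinv_mul_sqrt_le hS hA hAS _)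
    rw [← Matrix.mulVec_mulVec, ← Matrix.mulVec_mulVec, Matrix.dotProduct_mulVec _ A,
      ← Matrix.mulVec_transpose, hA]
  · refine ⟨pinv S *ᵥ (A *ᵥ w), ?_⟩
    simp only [Matrix.mulVec_mulVec]
    rw [← Matrix.mul_assoc, mul_pinv_mul_sqrt hS hA hAS]

/-- The vector of least norm with image `x` under the square root of `S`. -/
theorem exists_norm_sq_eq_pinvForm (hS : S.PosSemidef) (hA : Aᵀ = A) (hAS : A * A = S)
    {x : Fin k → ℝ} (hx : pinvForm S x ≠ ⊤) :
    ∃ w : EuclideanSpace ℝ (Fin k), (toEuclideanCLM (𝕜 := ℝ) A w : Fin k → ℝ) = x ∧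
      ENNReal.ofReal (‖w‖ ^ 2) = pinvForm S x := by
  have h := isMoorePenrose_pinv hS.isHermitian
  by_cases hr : x ∈ Set.range (fun y : Fin k → ℝ => S *ᵥ y)
  · refine ⟨WithLp.toLp 2 ((A * pinv S) *ᵥ x), ?_, ?_⟩
    · obtain ⟨y, rfl⟩ := hr
      rw [toEuclideanCLM_apply]
      simp only [Matrix.mulVec_mulVec]
      rw [← Matrix.mul_assoc, ← Matrix.mul_assoc, hAS, h.mul_mul_self]
    · rw [pinvForm, if_pos hr, norm_sq_eq_dotProduct]
      congr 1
      simp only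
      rw [← Matrix.mulVec_mulVec, Matrix.dotProduct_mulVec, ← Matrix.mulVec_transpose, hA,
        Matrix.mulVec_mulVec, hAS]
      obtain ⟨y, rfl⟩ := hr
      simp only [Matrix.mulVec_mulVec]
      rw [← Matrix.mul_assoc, h.mul_mul_self]
  · exact absurd (if_neg hr) hx

end Pinv

section tailRate

variable {k : ℕ} {S A : Matrix (Fin k) (Fin k) ℝ} {q : ℝ}

theorem ofReal_half_mul {a : ℝ} : ENNReal.ofReal (a / 2) = 2⁻¹ * ENNReal.ofReal a := by
  rw [div_eq_inv_mul, ENNReal.ofReal_mul (by norm_num), ENNReal.ofReal_inv_of_pos two_pos,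
    ENNReal.ofReal_ofNat]

/-- The signs of the coordinates of `T w` realise the form of `T w` as one of those minimised in
`Jbar`, so a single jump `w` covering `u` costs at least the tail rate of `u`. -/
theorem tailRate_le (hS : S.IsHermitian) (hA : Aᵀ = A) (hAS : A * A = S) (hq : 0 < q)
    {u : Fin k → ℝ} (w : EuclideanSpace ℝ (Fin k))
    (hu : u ≤ absPow (toEuclideanCLM (𝕜 := ℝ) A) q w) :
    tailRate S q u ≤ ENNReal.ofReal (‖w‖ ^ 2 / 2) := by
  classical
  refine (iInf₂_le _ hu).trans ?_
  rw [ofReal_half_mul, Jbar]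
  refine mul_le_mul_right ((iInf_le _ fun j =>
    if 0 ≤ toEuclideanCLM (𝕜 := ℝ) A w j then 1 else -1).trans ?_) _
  refine le_trans (le_of_eq ?_) (pinvForm_le hS hA hAS w)
  congr 1
  funext j
  rw [absPow, ← Real.rpow_mul (abs_nonneg _), mul_one_div_cancel hq.ne', Real.rpow_one]
  beta_reduce
  generalize (toEuclideanCLM (𝕜 := ℝ) A w).ofLp j = x
  split_ifs with h
  · simp [abs_of_nonneg h]
  · simp [abs_of_neg (not_le.1 h)]

/-- Conversely, the tail rate of `u` is approached by single jumps covering `u`. -/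
theorem exists_lt_of_tailRate_lt (hS : S.PosSemidef) (hA : Aᵀ = A) (hAS : A * A = S) (hq : 0 < q)
    {u : Fin k → ℝ} (hu : 0 ≤ u) {c : ℝ≥0∞} (hc : tailRate S q u < c) :
    ∃ w : EuclideanSpace ℝ (Fin k), u ≤ absPow (toEuclideanCLM (𝕜 := ℝ) A) q w ∧
      ENNReal.ofReal (‖w‖ ^ 2 / 2) < c := by
  simp only [tailRate, iInf_lt_iff] at hc
  obtain ⟨s, hs, hc⟩ := hc
  obtain ⟨ε, hε⟩ := exists_eq_ciInf_of_finite
    (f := fun ε : Fin k → ℤˣ => pinvForm S fun j => ((ε j : ℤ) : ℝ) * s j ^ (1 / q))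
  rw [Jbar, ← hε] at hc
  obtain ⟨w, hw, hwn⟩ := exists_norm_sq_eq_pinvForm hS hA hAS
    (x := fun j => ((ε j : ℤ) : ℝ) * s j ^ (1 / q)) (by
      intro htop
      rw [htop, ENNReal.mul_top (by simp)] at hc
      exact not_top_lt hc)
  refine ⟨w, fun j => ?_, by rwa [ofReal_half_mul, hwn]⟩
  have hsj : 0 ≤ s j := (hu j).trans (hs j)
  have h1 : |((ε j : ℤ) : ℝ)| = 1 := by
    rcases Int.units_eq_one_or (ε j) with h | h <;> simp [h]
  rw [absPow, congrFun hw j, abs_mul, h1, one_mul, abs_of_nonneg (Real.rpow_nonneg hsj _),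
    ← Real.rpow_mul hsj, one_div_mul_cancel hq.ne', Real.rpow_one]
  exact hs j

/-- Splitting `t` into `k` parts and covering each of them by one jump is the same as covering `t`
by `k` jumps. -/
theorem jumpRate_le_sum_tailRate (hS : S.PosSemidef) (hA : Aᵀ = A) (hAS : A * A = S) (hq : 0 < q)
    {t : Fin k → ℝ} {u : Fin k → Fin k → ℝ} (hu : ∀ r, 0 ≤ u r) (hut : ∑ r, u r = t) :
    jumpRate (toEuclideanCLM (𝕜 := ℝ) A) q t ≤ ∑ r, tailRate S q (u r) := by
  by_cases htop : ∑ r, tailRate S q (u r) = ⊤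
  · rw [htop]; exact le_top
  have hfin : ∀ r, tailRate S q (u r) ≠ ⊤ := fun r =>
    (ENNReal.sum_lt_top.1 (lt_top_iff_ne_top.2 htop) r (Finset.mem_univ r)).ne
  refine ENNReal.le_of_forall_pos_le_add fun ε hε _ => ?_
  set δ : ℝ≥0∞ := (ε : ℝ≥0∞) / (k + 1) with hδ
  have hδ0 : δ ≠ 0 := (ENNReal.div_pos (by simpa using hε.ne') (by finiteness)).ne'
  choose w hw hwc using fun r => exists_lt_of_tailRate_lt hS hA hAS hq (hu r)
    (ENNReal.lt_add_right (hfin r) hδ0)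
  refine (jumpRate_le w fun j => ?_).trans ?_
  · rw [← hut, Finset.sum_apply]
    exact Finset.sum_le_sum fun r _ => hw r j
  · rw [ENNReal.ofReal_sum_of_nonneg fun r _ => by positivity]
    refine (Finset.sum_le_sum fun r _ => (hwc r).le).trans ?_
    rw [Finset.sum_add_distrib]
    gcongr
    simp only [Finset.sum_const, Finset.card_univ, Fintype.card_fin, nsmul_eq_mul]
    calc (k : ℝ≥0∞) * δ ≤ (k + 1) * δ := by gcongr; exact le_self_add
      _ ≤ ε := ENNReal.mul_div_le

/-- An optimal family of jumps overshoots `t` by a factor in each coordinate; dividing its effects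
by these factors gives an optimal decomposition of `t`. -/
theorem jumpRate_mem_decompositionCosts (hS : S.PosSemidef) (hA : Aᵀ = A) (hAS : A * A = S)
    (hq : 2 < q) {t : Fin k → ℝ} (ht : ∀ j, 0 < t j) :
    jumpRate (toEuclideanCLM (𝕜 := ℝ) A) q t ∈ decompositionCosts (tailRate S q) t := by
  have hq0 : 0 < q := by linarith
  by_cases htop : jumpRate (toEuclideanCLM (𝕜 := ℝ) A) q t = ⊤
  · -- every decomposition has infinite cost
    have h1 : ∀ r : Fin k, 0 ≤ Pi.single (M := fun _ => ℝ) r (t r) := fun r =>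
      Pi.single_nonneg.2 (ht r).le
    have h2 : ∑ r, Pi.single (M := fun _ => ℝ) r (t r) = t := Finset.univ_sum_single t
    refine ⟨_, h1, h2, ?_⟩
    have := jumpRate_le_sum_tailRate hS hA hAS hq0 h1 h2
    rw [htop, top_le_iff] at this
    rw [htop, this]
  · obtain ⟨w, hw, he⟩ := exists_eq_jumpRate hq htop
    set σ : Fin k → ℝ := fun j => ∑ r, absPow (toEuclideanCLM (𝕜 := ℝ) A) q (w r) j with hσ
    have hσ0 : ∀ j, 0 < σ j := fun j => (ht j).trans_le (hw j)
    set u : Fin k → Fin k → ℝ := fun r j =>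
      t j / σ j * absPow (toEuclideanCLM (𝕜 := ℝ) A) q (w r) j with hu
    have h1 : ∀ r, 0 ≤ u r := fun r j =>
      mul_nonneg (div_nonneg (ht j).le (hσ0 j).le) (absPow_nonneg _ _)
    have h2 : ∑ r, u r = t := by
      funext j
      simp only [hu, Finset.sum_apply]
      rw [← Finset.mul_sum]
      exact div_mul_cancel₀ _ (hσ0 j).ne'
    refine ⟨u, h1, h2, le_antisymm (jumpRate_le_sum_tailRate hS hA hAS hq0 h1 h2) ?_⟩
    rw [he, ENNReal.ofReal_sum_of_nonneg fun r _ => by positivity]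
    refine Finset.sum_le_sum fun r _ => tailRate_le hS.isHermitian hA hAS hq0 _ fun j => ?_
    exact mul_le_of_le_one_left (absPow_nonneg _ _) ((div_le_one (hσ0 j)).2 (hw j))

theorem isLeast_jumpRate (hS : S.PosSemidef) (hA : Aᵀ = A) (hAS : A * A = S)
    (hq : 2 < q) {t : Fin k → ℝ} (ht : ∀ j, 0 < t j) :
    IsLeast (decompositionCosts (tailRate S q) t)
      (jumpRate (toEuclideanCLM (𝕜 := ℝ) A) q t) := by
  refine ⟨jumpRate_mem_decompositionCosts hS hA hAS hq ht, ?_⟩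
  rintro c ⟨u, hu, hut, rfl⟩
  exact jumpRate_le_sum_tailRate hS hA hAS (by linarith) hu hut

theorem rateI_eq_jumpRate (hS : S.PosSemidef) (hA : Aᵀ = A) (hAS : A * A = S)
    (hq : 2 < q) {t : Fin k → ℝ} (ht : ∀ j, 0 < t j) :
    rateI (tailRate S q) t = jumpRate (toEuclideanCLM (𝕜 := ℝ) A) q t :=
  (isLeast_jumpRate hS hA hAS hq ht).csInf_eq

end tailRate

/-! ### The upper bound -/

section Upper

variable {Ω : Type*} [MeasurableSpace Ω] {P : Measure Ω} [IsProbabilityMeasure P]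
  {k : ℕ} {Z : ℕ → Ω → EuclideanSpace ℝ (Fin k)} {μ : Measure (EuclideanSpace ℝ (Fin k))}
  {T : EuclideanSpace ℝ (Fin k) →L[ℝ] EuclideanSpace ℝ (Fin k)} {q : ℝ}

/-- Exponential Chebyshev inequality for a sum of i.i.d. variables. -/
theorem measureReal_le_sum_le (hZ : ∀ i, Measurable (Z i)) (hind : iIndepFun Z P)
    (hμ : ∀ i, P.map (Z i) = μ) {f : EuclideanSpace ℝ (Fin k) → ℝ} (hf : Measurable f)
    (hint : Integrable (fun z => Real.exp (f z)) μ) (N : ℕ) (a : ℝ) :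
    P.real {ω | a ≤ ∑ i ∈ Finset.range N, f (Z i ω)} ≤
      Real.exp (-a) * (∫ z, Real.exp (f z) ∂μ) ^ N := by
  have hind' : iIndepFun (fun i ω => f (Z i ω)) P := hind.comp (fun _ => f) fun _ => hf
  have hm : ∀ i, Measurable fun ω => f (Z i ω) := fun i => hf.comp (hZ i)
  have hmgf : ∀ i, mgf (fun ω => f (Z i ω)) P 1 = ∫ z, Real.exp (f z) ∂μ := fun i => by
    rw [← hμ i, integral_map (hZ i).aemeasurable (by fun_prop)]
    simp [mgf]
  have hi : ∀ i ∈ Finset.range N, Integrable (fun ω => Real.exp (1 * f (Z i ω))) P := by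
    intro i _
    rw [← hμ i] at hint
    simpa [Function.comp_def] using hint.comp_measurable (hZ i)
  have h := measure_ge_le_exp_mul_mgf (μ := P) (X := ∑ i ∈ Finset.range N, fun ω => f (Z i ω)) a
    zero_le_one (hind'.integrable_exp_mul_sum hm hi)
  rw [hind'.mgf_sum hm] at h
  simpa [hmgf, Finset.sum_apply] using h

theorem tendsto_natCast_rpow_atTop {p : ℝ} (hp : 0 < p) :
    Tendsto (fun N : ℕ => (N : ℝ) ^ p) atTop atTop :=
  (tendsto_rpow_atTop hp).comp tendsto_natCast_atTop_atTop

theorem exp_le_one_add_add_sq_mul_exp {x : ℝ} (hx : 0 ≤ x) :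
    Real.exp x ≤ 1 + x + x ^ 2 * Real.exp x := by
  have h1 : 1 - x ≤ Real.exp (-x) := by linarith [Real.add_one_le_exp (-x)]
  have h2 : Real.exp (-x) * Real.exp x = 1 := by rw [← Real.exp_add]; simp
  have h3 : (1 - x) * Real.exp x ≤ 1 :=
    (mul_le_mul_of_nonneg_right h1 (Real.exp_pos x).le).trans h2.le
  nlinarith

theorem rpow_le_mul_exp {y r : ℝ} (hy : 0 ≤ y) (hr : 0 < r) :
    y ^ r ≤ (8 * r) ^ r * Real.exp (y / 8) := by
  have h1 : y / (8 * r) ≤ Real.exp (y / (8 * r)) := by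
    linarith [Real.add_one_le_exp (y / (8 * r))]
  calc y ^ r = (8 * r) ^ r * (y / (8 * r)) ^ r := by
        rw [← Real.mul_rpow (by positivity) (by positivity)]
        congr 1; field_simp
    _ ≤ (8 * r) ^ r * Real.exp (y / (8 * r)) ^ r := by gcongr
    _ = _ := by
        rw [← Real.exp_mul]
        congr 2; field_simp

theorem integrable_absPow (hq : 2 < q)
    (hexp : ∀ c < (1 / 2 : ℝ), Integrable (fun z => Real.exp (c * ‖z‖ ^ 2)) μ) (j : Fin k) :
    Integrable (fun z => absPow T q z j) μ := by
  have hq0 : 0 < q := by linarith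
  refine ((hexp (1 / 8) (by norm_num)).const_mul (‖T‖ ^ q * (8 * (q / 2)) ^ (q / 2))).mono'
    (continuous_absPow hq0 j).aestronglyMeasurable (ae_of_all _ fun z => ?_)
  rw [Real.norm_of_nonneg (absPow_nonneg z j), mul_assoc]
  refine (absPow_le hq0 z j).trans ?_
  gcongr
  have := rpow_le_mul_exp (sq_nonneg ‖z‖) (half_pos hq0)
  rw [← Real.rpow_natCast, ← Real.rpow_mul (norm_nonneg _)] at this
  calc ‖z‖ ^ q = ‖z‖ ^ (((2 : ℕ) : ℝ) * (q / 2)) := by congr 1; push_cast; ring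
    _ ≤ _ := this
    _ = _ := by rw [Real.rpow_natCast]; congr 2; ring

open Classical in
/-- The contribution of the small vectors `‖Z_i‖ ≤ δ N^{1/q}` has deviations from the mean that are
negligible on the scale `N^{2/q}`, for every prescribed rate `L`, once `δ` is small enough.
With the parameter `θ ≍ N^{2/q-1}`, the exponent `θ |(T z)_j|^q` is at most `‖z‖² / 8` for
such vectors. -/
theorem eventually_measureReal_truncated_le (hq : 2 < q) [IsProbabilityMeasure μ]
    (hZ : ∀ i, Measurable (Z i)) (hind : iIndepFun Z P)
    (hμ : ∀ i, P.map (Z i) = μ)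
    (hexp : ∀ c < (1 / 2 : ℝ), Integrable (fun z => Real.exp (c * ‖z‖ ^ 2)) μ)
    (j : Fin k) {a L : ℝ} (ha : 0 < a) (hL : 0 ≤ L) :
    ∀ᶠ δ in 𝓝[>] (0 : ℝ), ∀ᶠ N : ℕ in atTop,
      P.real {ω | (N : ℝ) * ((∫ z, absPow T q z j ∂μ) + a) ≤ ∑ i ∈ Finset.range N,
        if ‖Z i ω‖ ≤ δ * (N : ℝ) ^ (1 / q) then absPow T q (Z i ω) j else 0} ≤
      Real.exp (-((N : ℝ) ^ (2 / q) * L)) := by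
  have hq0 : 0 < q := by linarith
  set m := ∫ z, absPow T q z j ∂μ with hm
  set Λ := (L + 1) / a with hΛ
  have hΛ0 : 0 < Λ := by positivity
  set K := ‖T‖ ^ q with hK
  have hK0 : 0 ≤ K := Real.rpow_nonneg (norm_nonneg _) _
  have hδlim : Tendsto (fun δ : ℝ => Λ * K * δ ^ (q - 2)) (𝓝[>] 0) (𝓝 0) := by
    have h := ((Real.continuousAt_rpow_const 0 (q - 2) (Or.inr (by linarith))).tendsto).const_mul
      (Λ * K)
    rw [Real.zero_rpow (by linarith), mul_zero] at h
    exact h.mono_left nhdsWithin_le_nhds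
  filter_upwards [hδlim.eventually (eventually_le_nhds (by norm_num : (0 : ℝ) < 1 / 8)),
    self_mem_nhdsWithin] with δ hδ hδ0
  replace hδ0 : 0 < δ := hδ0
  set C := K ^ 2 * (8 * q) ^ q * ∫ z, Real.exp (1 / 4 * ‖z‖ ^ 2) ∂μ with hC
  have hlim : Tendsto (fun N : ℕ => C * Λ ^ 2 * (N : ℝ) ^ (2 / q - 1)) atTop (𝓝 0) := by
    have h1 : 0 < 1 - 2 / q := by rw [sub_pos, div_lt_one hq0]; exact hq
    have h := ((tendsto_rpow_neg_atTop h1).comp tendsto_natCast_atTop_atTop).const_mul (C * Λ ^ 2)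
    simpa [Function.comp_def] using h
  filter_upwards [hlim.eventually (eventually_le_nhds one_pos), eventually_ge_atTop 1] with N hN hN1
  have hNpos : (0 : ℝ) < N := by exact_mod_cast hN1
  set θ := Λ * (N : ℝ) ^ (2 / q - 1) with hθ
  have hθ0 : 0 < θ := mul_pos hΛ0 (Real.rpow_pos_of_pos hNpos _)
  have hθN : θ * N = Λ * (N : ℝ) ^ (2 / q) := by
    rw [hθ, mul_assoc, ← Real.rpow_add_one hNpos.ne']; congr 2; ring
  set f : EuclideanSpace ℝ (Fin k) → ℝ := fun z =>
    θ * if ‖z‖ ≤ δ * (N : ℝ) ^ (1 / q) then absPow T q z j else 0 with hf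
  have hfm : Measurable f := by
    refine Measurable.const_mul (Measurable.ite ?_ (continuous_absPow hq0 j).measurable
      measurable_const) _
    exact measurableSet_le measurable_norm measurable_const
  have hf0 : ∀ z, 0 ≤ f z := fun z => by
    refine mul_nonneg hθ0.le ?_
    split_ifs
    exacts [absPow_nonneg z j, le_rfl]
  have hf1 : ∀ z, f z ≤ θ * absPow T q z j := fun z => by
    refine mul_le_mul_of_nonneg_left ?_ hθ0.le
    split_ifs
    exacts [le_rfl, absPow_nonneg z j]
  have hf2 : ∀ z, f z ≤ ‖z‖ ^ 2 / 8 := fun z => by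
    by_cases hz : ‖z‖ ≤ δ * (N : ℝ) ^ (1 / q)
    · refine (hf1 z).trans ((mul_le_mul_of_nonneg_left (absPow_le hq0 z j) hθ0.le).trans ?_)
      have e1 : ‖z‖ ^ q = ‖z‖ ^ (q - 2) * ‖z‖ ^ 2 := by
        rw [← Real.rpow_natCast, ← Real.rpow_add' (norm_nonneg _) (by push_cast; linarith)]
        congr 1; push_cast; ring
      have e2 : ‖z‖ ^ (q - 2) ≤ δ ^ (q - 2) * (N : ℝ) ^ (1 - 2 / q) := by
        refine (Real.rpow_le_rpow (norm_nonneg _) hz (by linarith)).trans (le_of_eq ?_)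
        rw [Real.mul_rpow hδ0.le (Real.rpow_nonneg hNpos.le _), ← Real.rpow_mul hNpos.le]
        congr 2; field_simp
      have e3 : (N : ℝ) ^ (2 / q - 1) * (N : ℝ) ^ (1 - 2 / q) = 1 := by
        rw [← Real.rpow_add hNpos]; simp
      calc θ * (K * ‖z‖ ^ q) = θ * K * ‖z‖ ^ (q - 2) * ‖z‖ ^ 2 := by rw [e1]; ring
        _ ≤ θ * K * (δ ^ (q - 2) * (N : ℝ) ^ (1 - 2 / q)) * ‖z‖ ^ 2 := by gcongr
        _ = Λ * K * δ ^ (q - 2) * ((N : ℝ) ^ (2 / q - 1) * (N : ℝ) ^ (1 - 2 / q)) * ‖z‖ ^ 2 := by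
            rw [hθ]; ring
        _ ≤ 1 / 8 * 1 * ‖z‖ ^ 2 := by rw [e3]; gcongr
        _ = _ := by ring
    · simp only [hf, if_neg hz, mul_zero]
      positivity
  have hf3 : ∀ z, Real.exp (f z) ≤ 1 + θ * absPow T q z j +
      θ ^ 2 * (K ^ 2 * (8 * q) ^ q * Real.exp (1 / 4 * ‖z‖ ^ 2)) := fun z => by
    refine (exp_le_one_add_add_sq_mul_exp (hf0 z)).trans ?_
    have e1 : f z ^ 2 ≤ θ ^ 2 * (K ^ 2 * ((8 * q) ^ q * Real.exp (‖z‖ ^ 2 / 8))) := by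
      calc f z ^ 2 ≤ (θ * (K * ‖z‖ ^ q)) ^ 2 :=
            pow_le_pow_left₀ (hf0 z) ((hf1 z).trans
              (mul_le_mul_of_nonneg_left (absPow_le hq0 z j) hθ0.le)) 2
        _ = θ ^ 2 * (K ^ 2 * (‖z‖ ^ 2) ^ q) := by
            rw [mul_pow θ, mul_pow K, ← Real.rpow_natCast (‖z‖ ^ q), ← Real.rpow_mul (norm_nonneg _),
              ← Real.rpow_natCast ‖z‖, ← Real.rpow_mul (norm_nonneg _), mul_comm q]
        _ ≤ _ := by gcongr; exact rpow_le_mul_exp (sq_nonneg _) hq0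
    have e2 : Real.exp (‖z‖ ^ 2 / 8) * Real.exp (‖z‖ ^ 2 / 8) = Real.exp (1 / 4 * ‖z‖ ^ 2) := by
      rw [← Real.exp_add]; congr 1; ring
    have e3 : f z ^ 2 * Real.exp (f z) ≤
        θ ^ 2 * (K ^ 2 * (8 * q) ^ q * Real.exp (1 / 4 * ‖z‖ ^ 2)) := by
      calc _ ≤ θ ^ 2 * (K ^ 2 * ((8 * q) ^ q * Real.exp (‖z‖ ^ 2 / 8))) *
            Real.exp (‖z‖ ^ 2 / 8) := by
            gcongr
            exact hf2 z
        _ = _ := by rw [← e2]; ring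
    linarith [hf1 z]
  have hint8 := hexp (1 / 8) (by norm_num)
  have hint : Integrable (fun z => Real.exp (f z)) μ := by
    refine hint8.mono' (by fun_prop) (ae_of_all _ fun z => ?_)
    rw [Real.norm_of_nonneg (Real.exp_pos _).le]
    exact Real.exp_le_exp.2 (by linarith [hf2 z])
  have hI := integrable_absPow (T := T) hq hexp j
  have hI4 := hexp (1 / 4) (by norm_num)
  have hbound : ∫ z, Real.exp (f z) ∂μ ≤ Real.exp (θ * m + θ ^ 2 * C) := by
    refine (integral_mono hint (((integrable_const 1).add (hI.const_mul θ)).add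
      ((hI4.const_mul (K ^ 2 * (8 * q) ^ q)).const_mul (θ ^ 2))) hf3).trans ?_
    rw [integral_add' ((integrable_const 1).add (hI.const_mul θ))
      ((hI4.const_mul (K ^ 2 * (8 * q) ^ q)).const_mul (θ ^ 2)),
      integral_add' (integrable_const 1) (hI.const_mul θ), integral_const_mul, integral_const_mul,
      integral_const_mul]
    simp only [integral_const, probReal_univ, smul_eq_mul, mul_one]
    rw [← hm, ← hC]
    linarith [Real.add_one_le_exp (θ * m + θ ^ 2 * C)]
  have hmain := measureReal_le_sum_le hZ hind hμ hfm hint N (θ * (N * (m + a)))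
  have hset : {ω | (N : ℝ) * (m + a) ≤ ∑ i ∈ Finset.range N,
        if ‖Z i ω‖ ≤ δ * (N : ℝ) ^ (1 / q) then absPow T q (Z i ω) j else 0} =
      {ω | θ * (N * (m + a)) ≤ ∑ i ∈ Finset.range N, f (Z i ω)} := by
    ext ω
    simp only [Set.mem_ofPred_eq, hf, ← Finset.mul_sum]
    rw [mul_le_mul_iff_right₀ hθ0]
  rw [hset]
  refine hmain.trans ?_
  calc Real.exp (-(θ * (N * (m + a)))) * (∫ z, Real.exp (f z) ∂μ) ^ N
      ≤ Real.exp (-(θ * (N * (m + a)))) * Real.exp (θ * m + θ ^ 2 * C) ^ N := by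
        gcongr
    _ = Real.exp (-(θ * (N * (m + a))) + N * (θ * m + θ ^ 2 * C)) := by
        rw [← Real.exp_nat_mul, ← Real.exp_add]
    _ ≤ _ := by
        refine Real.exp_le_exp.2 ?_
        have e1 : N * (θ ^ 2 * C) = (N : ℝ) ^ (2 / q) * (C * Λ ^ 2 * (N : ℝ) ^ (2 / q - 1)) := by
          calc N * (θ ^ 2 * C) = (θ * N) * (θ * C) := by ring
            _ = _ := by rw [hθN, hθ]; ring
        have e2 : θ * N * a = (N : ℝ) ^ (2 / q) * (L + 1) := by
          rw [hθN, hΛ]; field_simp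
        have e3 := mul_le_mul_of_nonneg_left hN (Real.rpow_nonneg hNpos.le (2 / q))
        rw [← e1] at e3
        nlinarith

open Classical in
/-- The total energy of the large vectors `‖Z_i‖ > δ N^{1/q}` has Gaussian-type exponential tails:
the exponential moments of a single summand are so close to `1` that the product of `N` of them
stays bounded. -/
theorem exists_eventually_measureReal_large_le (hq : 2 < q) [IsProbabilityMeasure μ]
    (hZ : ∀ i, Measurable (Z i)) (hind : iIndepFun Z P)
    (hμ : ∀ i, P.map (Z i) = μ)
    (hexp : ∀ c < (1 / 2 : ℝ), Integrable (fun z => Real.exp (c * ‖z‖ ^ 2)) μ)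
    {c δ : ℝ} (hc0 : 0 ≤ c) (hc : c < 1 / 2) (hδ : 0 < δ) :
    ∃ C, ∀ᶠ N : ℕ in atTop, ∀ a,
      P.real {ω | a ≤ ∑ i ∈ Finset.range N,
        if ‖Z i ω‖ ≤ δ * (N : ℝ) ^ (1 / q) then 0 else c * ‖Z i ω‖ ^ 2} ≤
      C * Real.exp (-a) := by
  have hq0 : 0 < q := by linarith
  set c' := (c + 1 / 2) / 2 with hc'
  have hcc' : c < c' := by rw [hc']; linarith
  set D := ∫ z, Real.exp (c' * ‖z‖ ^ 2) ∂μ with hD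
  have hD0 : 0 ≤ D := integral_nonneg fun z => (Real.exp_pos _).le
  have hintD := hexp c' (by rw [hc']; linarith)
  set b := (c' - c) * δ ^ 2 with hb
  have hb0 : 0 < b := mul_pos (sub_pos.2 hcc') (by positivity)
  have hlim : Tendsto (fun N : ℕ => (N : ℝ) * Real.exp (-b * (N : ℝ) ^ (2 / q))) atTop (𝓝 0) := by
    have h := (tendsto_rpow_mul_exp_neg_mul_atTop_nhds_zero (q / 2) b hb0).comp
      (tendsto_natCast_rpow_atTop (p := 2 / q) (by positivity))
    refine h.congr fun N => ?_
    simp only [Function.comp_apply]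
    rw [← Real.rpow_mul (Nat.cast_nonneg N), show 2 / q * (q / 2) = 1 by field_simp, Real.rpow_one]
  refine ⟨Real.exp D, ?_⟩
  filter_upwards [hlim.eventually (eventually_le_nhds one_pos)] with N hN a
  set f : EuclideanSpace ℝ (Fin k) → ℝ := fun z =>
    if ‖z‖ ≤ δ * (N : ℝ) ^ (1 / q) then 0 else c * ‖z‖ ^ 2 with hf
  have hfm : Measurable f :=
    Measurable.ite (measurableSet_le measurable_norm measurable_const) measurable_const
      (by fun_prop)
  have hle : ∀ z, f z ≤ c * ‖z‖ ^ 2 := fun z => by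
    simp only [hf]; split_ifs
    · positivity
    · exact le_rfl
  have hint : Integrable (fun z => Real.exp (f z)) μ := by
    refine (hexp c hc).mono' (by fun_prop) (ae_of_all _ fun z => ?_)
    rw [Real.norm_of_nonneg (Real.exp_pos _).le]
    exact Real.exp_le_exp.2 (hle z)
  have hbd : ∀ z, Real.exp (f z) ≤
      1 + Real.exp (-b * (N : ℝ) ^ (2 / q)) * Real.exp (c' * ‖z‖ ^ 2) := fun z => by
    simp only [hf]; split_ifs with hz
    · rw [Real.exp_zero]
      have := mul_pos (Real.exp_pos (-b * (N : ℝ) ^ (2 / q))) (Real.exp_pos (c' * ‖z‖ ^ 2))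
      linarith
    · rw [← Real.exp_add]
      refine le_trans (Real.exp_le_exp.2 ?_) (le_add_of_nonneg_left zero_le_one)
      have e1 : δ ^ 2 * (N : ℝ) ^ (2 / q) ≤ ‖z‖ ^ 2 := by
        have := pow_le_pow_left₀ (by positivity) (not_le.1 hz).le 2
        rwa [mul_pow, ← Real.rpow_natCast ((N : ℝ) ^ (1 / q)), ← Real.rpow_mul (Nat.cast_nonneg N),
          show 1 / q * ((2 : ℕ) : ℝ) = 2 / q by push_cast; ring] at this
      have := mul_le_mul_of_nonneg_left e1 (sub_pos.2 hcc').le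
      rw [hb]
      nlinarith
  have hbound : ∫ z, Real.exp (f z) ∂μ ≤
      Real.exp (Real.exp (-b * (N : ℝ) ^ (2 / q)) * D) := by
    refine (integral_mono hint ((integrable_const 1).add (hintD.const_mul _)) hbd).trans ?_
    rw [integral_add' (integrable_const 1) (hintD.const_mul _), integral_const_mul]
    simp only [integral_const, probReal_univ, smul_eq_mul, mul_one]
    rw [← hD]
    linarith [Real.add_one_le_exp (Real.exp (-b * (N : ℝ) ^ (2 / q)) * D)]
  refine (measureReal_le_sum_le hZ hind hμ hfm hint N a).trans ?_
  rw [mul_comm]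
  gcongr
  calc (∫ z, Real.exp (f z) ∂μ) ^ N
      ≤ Real.exp (Real.exp (-b * (N : ℝ) ^ (2 / q)) * D) ^ N := by gcongr
    _ = Real.exp (N * Real.exp (-b * (N : ℝ) ^ (2 / q)) * D) := by
        rw [← Real.exp_nat_mul, mul_assoc]
    _ ≤ Real.exp D := Real.exp_le_exp.2 (mul_le_of_le_one_left hD0 hN)

/-- The upper bound: if every family of jumps reaching `t` costs at least `l > L`, then the
probability of the deviation `t` is at most `exp (-N^{2/q} L)`. -/
theorem eventually_measureReal_le_exp (hq : 2 < q) [IsProbabilityMeasure μ]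
    (hZ : ∀ i, Measurable (Z i)) (hind : iIndepFun Z P)
    (hμ : ∀ i, P.map (Z i) = μ)
    (hexp : ∀ c < (1 / 2 : ℝ), Integrable (fun z => Real.exp (c * ‖z‖ ^ 2)) μ)
    {t : Fin k → ℝ} (ht : ∀ j, 0 < t j) {l L : ℝ} (hl : ENNReal.ofReal l ≤ jumpRate T q t)
    (hL0 : 0 ≤ L) (hL : L < l) :
    ∀ᶠ N : ℕ in atTop,
      P.real {ω | ∀ j, t j ≤ (1 / (N : ℝ)) * ∑ i ∈ Finset.range N,
        (absPow T q (Z i ω) j - ∫ z, absPow T q z j ∂μ)} ≤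
      Real.exp (-((N : ℝ) ^ (2 / q) * L)) := by
  classical
  have hq0 : 0 < q := by linarith
  have hl0 : 0 < l := hL0.trans_lt hL
  -- the loss factor `σ < 1` satisfies `σ² l ≥ (l + L) / 2 > L`
  set σ := (3 + L / l) / 4 with hσ
  have hLl : L / l < 1 := (div_lt_one hl0).2 hL
  have hLl0 : 0 ≤ L / l := div_nonneg hL0 hl0.le
  have hσ0 : 0 < σ := by rw [hσ]; linarith
  have hσ1 : σ < 1 := by rw [hσ]; linarith
  have hσl : (l + L) / 2 ≤ σ * (σ * l) := by
    have e : L = L / l * l := by field_simp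
    have h1 : (1 + L / l) / 2 ≤ σ * σ := by rw [hσ]; nlinarith [sq_nonneg (1 - L / l)]
    calc (l + L) / 2 = (1 + L / l) / 2 * l := by field_simp
      _ ≤ σ * σ * l := by gcongr
      _ = _ := by ring
  have htr := eventually_all.2 fun j => eventually_measureReal_truncated_le (T := T) hq hZ hind hμ
    hexp j (mul_pos (sub_pos.2 hσ1) (ht j)) (by positivity : 0 ≤ (l + L) / 2)
  obtain ⟨δ, hδ, hδ0⟩ := (htr.and self_mem_nhdsWithin).exists
  replace hδ0 : 0 < δ := hδ0
  obtain ⟨C, hC⟩ := exists_eventually_measureReal_large_le hq hZ hind hμ hexp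
    (c := σ / 2) (by positivity) (by linarith) hδ0
  have hbig : ∀ᶠ N : ℕ in atTop, k + C ≤ Real.exp ((l - L) / 2 * (N : ℝ) ^ (2 / q)) :=
    (Real.tendsto_exp_atTop.comp (Tendsto.const_mul_atTop (by linarith : 0 < (l - L) / 2)
      (tendsto_natCast_rpow_atTop (p := 2 / q) (by positivity)))).eventually_ge_atTop _
  filter_upwards [eventually_all.2 hδ, hC, hbig, eventually_ge_atTop 1] with N h1 h2 h3 hN1
  have hNpos : (0 : ℝ) < N := by exact_mod_cast hN1
  set m : Fin k → ℝ := fun j => ∫ z, absPow T q z j ∂μ with hm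
  set small : Fin k → Set Ω := fun j => {ω | (N : ℝ) * (m j + (1 - σ) * t j) ≤
    ∑ i ∈ Finset.range N,
      if ‖Z i ω‖ ≤ δ * (N : ℝ) ^ (1 / q) then absPow T q (Z i ω) j else 0} with hsmall
  set large : Set Ω := {ω | (N : ℝ) ^ (2 / q) * ((l + L) / 2) ≤ ∑ i ∈ Finset.range N,
    if ‖Z i ω‖ ≤ δ * (N : ℝ) ^ (1 / q) then 0 else σ / 2 * ‖Z i ω‖ ^ 2} with hlarge
  have hsub : {ω | ∀ j, t j ≤ (1 / (N : ℝ)) * ∑ i ∈ Finset.range N,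
      (absPow T q (Z i ω) j - m j)} ⊆ (⋃ j, small j) ∪ large := by
    intro ω hω
    by_contra hcon
    simp only [Set.mem_union, Set.mem_iUnion, not_or, not_exists] at hcon
    obtain ⟨hs, hlg⟩ := hcon
    refine hlg ?_
    set B := (Finset.range N).filter fun i => ¬ ‖Z i ω‖ ≤ δ * (N : ℝ) ^ (1 / q) with hB
    have hcov : ∀ j, σ * N * t j ≤ ∑ i ∈ B, absPow T q (Z i ω) j := fun j => by
      have e1 := hω j
      rw [one_div, inv_mul_eq_div, le_div_iff₀ hNpos, Finset.sum_sub_distrib] at e1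
      simp only [Finset.sum_const, Finset.card_range, nsmul_eq_mul] at e1
      have e2 := hs j
      simp only [hsmall, Set.mem_ofPred_eq, not_le] at e2
      rw [← Finset.sum_filter] at e2
      have e3 := Finset.sum_filter_add_sum_filter_not (Finset.range N)
        (fun i => ‖Z i ω‖ ≤ δ * (N : ℝ) ^ (1 / q)) fun i => absPow T q (Z i ω) j
      rw [← hB] at e3
      nlinarith
    have e4 := rpow_mul_le_sum_of_le_jumpRate hq B (fun i => Z i ω) (mul_pos hσ0 hNpos) hl hcov
    have e5 : σ ≤ σ ^ (2 / q) := by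
      conv_lhs => rw [← Real.rpow_one σ]
      exact Real.rpow_le_rpow_of_exponent_ge hσ0 hσ1.le ((div_le_one hq0).2 hq.le)
    rw [hlarge, Set.mem_ofPred_eq]
    have e6 : ∑ i ∈ Finset.range N,
        (if ‖Z i ω‖ ≤ δ * (N : ℝ) ^ (1 / q) then 0 else σ / 2 * ‖Z i ω‖ ^ 2) =
        σ * ∑ i ∈ B, ‖Z i ω‖ ^ 2 / 2 := by
      rw [hB, Finset.sum_filter, Finset.mul_sum]
      refine Finset.sum_congr rfl fun i _ => ?_
      split_ifs
      · simp
      · ring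
    rw [e6]
    calc (N : ℝ) ^ (2 / q) * ((l + L) / 2) ≤ (N : ℝ) ^ (2 / q) * (σ * (σ * l)) := by gcongr
      _ ≤ (N : ℝ) ^ (2 / q) * (σ * (σ ^ (2 / q) * l)) := by gcongr
      _ = σ * ((σ * N) ^ (2 / q) * l) := by rw [Real.mul_rpow hσ0.le hNpos.le]; ring
      _ ≤ _ := by gcongr
  calc P.real {ω | ∀ j, t j ≤ (1 / (N : ℝ)) * ∑ i ∈ Finset.range N,
        (absPow T q (Z i ω) j - m j)}
      ≤ P.real (⋃ j, small j) + P.real large :=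
        (measureReal_mono hsub).trans (measureReal_union_le _ _)
    _ ≤ ∑ j, P.real (small j) + P.real large := by
        gcongr; exact measureReal_iUnion_fintype_le _
    _ ≤ ∑ _j : Fin k, Real.exp (-((N : ℝ) ^ (2 / q) * ((l + L) / 2))) +
          C * Real.exp (-((N : ℝ) ^ (2 / q) * ((l + L) / 2))) := by
        gcongr with j
        · exact h1 j
        · exact h2 _
    _ = (k + C) * Real.exp (-((N : ℝ) ^ (2 / q) * ((l + L) / 2))) := by
        simp only [Finset.sum_const, Finset.card_univ, Fintype.card_fin, nsmul_eq_mul]; ring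
    _ ≤ Real.exp ((l - L) / 2 * (N : ℝ) ^ (2 / q)) *
          Real.exp (-((N : ℝ) ^ (2 / q) * ((l + L) / 2))) := by gcongr
    _ = _ := by rw [← Real.exp_add]; congr 1; ring

end Upper

/-! ### The lower bound -/

section Lower

variable {Ω : Type*} [MeasurableSpace Ω] {P : Measure Ω} [IsProbabilityMeasure P]
  {k : ℕ} {Z : ℕ → Ω → EuclideanSpace ℝ (Fin k)} {μ : Measure (EuclideanSpace ℝ (Fin k))}
  {T : EuclideanSpace ℝ (Fin k) →L[ℝ] EuclideanSpace ℝ (Fin k)} {q : ℝ}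

/-- Weak law of large numbers for the summands after the first `n`. -/
theorem eventually_half_le_measureReal_tail (hq : 0 < q)
    (hZ : ∀ i, Measurable (Z i)) (hind : iIndepFun Z P) (hμ : ∀ i, P.map (Z i) = μ)
    (hI : ∀ j, Integrable (fun z => absPow T q z j) μ) (n : ℕ) {a : Fin k → ℝ}
    (ha : ∀ j, 0 < a j) :
    ∀ᶠ N : ℕ in atTop, 1 / 2 ≤ P.real {ω | ∀ j, -(N * a j) ≤
      ∑ i ∈ Finset.Ico n N, (absPow T q (Z i ω) j - ∫ z, absPow T q z j ∂μ)} := by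
  set m : Fin k → ℝ := fun j => ∫ z, absPow T q z j ∂μ with hm
  have hmeas : ∀ i j, Measurable fun ω => absPow T q (Z i ω) j := fun i j =>
    (continuous_absPow hq j).measurable.comp (hZ i)
  set Y : Fin k → ℕ → Ω → ℝ := fun j N ω => (∑ i ∈ Finset.range N, absPow T q (Z (n + i) ω) j) / N
    with hY
  have hae : ∀ j, ∀ᵐ ω ∂P, Tendsto (fun N : ℕ => Y j N ω) atTop (𝓝 (m j)) := by
    intro j
    have hid : ∀ i, IdentDistrib (Z (n + i)) (Z (n + 0)) P P := fun i =>
      ⟨(hZ _).aemeasurable, (hZ _).aemeasurable, by rw [hμ, hμ]⟩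
    have h := strong_law_ae_real (μ := P) (fun i ω => absPow T q (Z (n + i) ω) j) ?_ ?_
      (fun i => (hid i).comp (continuous_absPow hq j).measurable)
    · have e : m j = ∫ ω, absPow T q (Z (n + 0) ω) j ∂P := by
        simp only [hm]
        rw [← hμ (n + 0), integral_map (hZ _).aemeasurable
          (continuous_absPow hq j).aestronglyMeasurable]
      rw [e]
      exact h
    · have := hI j
      rw [← hμ (n + 0)] at this
      exact this.comp_measurable (hZ _)
    · intro i i' hii'
      exact (hind.indepFun (by omega : n + i ≠ n + i')).comp (continuous_absPow hq j).measurable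
        (continuous_absPow hq j).measurable
  have hprob : ∀ j, Tendsto (fun N => P.real {ω | a j ≤ ‖Y j N ω - m j‖}) atTop (𝓝 0) := fun j =>
    tendstoInMeasure_iff_measureReal_norm.1 (tendstoInMeasure_of_tendsto_ae (fun N =>
      ((Finset.measurable_sum _ fun i _ => hmeas _ j).div_const _).aestronglyMeasurable) (hae j))
      (a j) (ha j)
  have hsum : Tendsto (fun N => ∑ j, P.real {ω | a j ≤ ‖Y j (N - n) ω - m j‖}) atTop (𝓝 0) := by
    have := tendsto_finsetSum Finset.univ fun j (_ : j ∈ Finset.univ) => (hprob j).comp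
      (tendsto_sub_atTop_nat n)
    simpa [Function.comp_def] using this
  filter_upwards [hsum.eventually (eventually_le_nhds (by norm_num : (0 : ℝ) < 1 / 2)),
    eventually_gt_atTop n] with N hN hnN
  set good : Set Ω := {ω | ∀ j, -(N * a j) ≤
      ∑ i ∈ Finset.Ico n N, (absPow T q (Z i ω) j - m j)} with hgood
  have hsub : (Set.univ : Set Ω) ⊆ good ∪ ⋃ j, {ω | a j ≤ ‖Y j (N - n) ω - m j‖} := by
    intro ω _
    by_contra hcon
    simp only [Set.mem_union, Set.mem_iUnion, not_or, not_exists] at hcon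
    obtain ⟨h1, h2⟩ := hcon
    refine h1 fun j => ?_
    have h3 := h2 j
    simp only [Set.mem_ofPred_eq, not_le] at h3
    have hpos : (0 : ℝ) < (N - n : ℕ) := by exact_mod_cast Nat.sub_pos_of_lt hnN
    have hle : ((N - n : ℕ) : ℝ) ≤ N := by exact_mod_cast Nat.sub_le N n
    rw [Finset.sum_Ico_eq_sum_range, Finset.sum_sub_distrib]
    simp only [Finset.sum_const, Finset.card_range, nsmul_eq_mul]
    have h4 : ∑ i ∈ Finset.range (N - n), absPow T q (Z (n + i) ω) j =
        Y j (N - n) ω * (N - n : ℕ) := (div_mul_cancel₀ _ hpos.ne').symm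
    rw [h4]
    have h5 := (abs_lt.1 h3).1
    have h6 := mul_le_mul_of_nonneg_left h5.le hpos.le
    have h7 := mul_le_mul_of_nonneg_right hle (ha j).le
    nlinarith
  have h1 : 1 ≤ P.real good + ∑ j, P.real {ω | a j ≤ ‖Y j (N - n) ω - m j‖} := by
    calc (1 : ℝ) = P.real Set.univ := by simp
      _ ≤ _ := (measureReal_mono hsub).trans (measureReal_union_le _ _)
      _ ≤ _ := by gcongr; exact measureReal_iUnion_fintype_le _
  linarith

/-- The lower bound: the first `k` vectors realise the jumps `w_1, …, w_k`, inflated by a factor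
`c > 1`, and the remaining ones follow the law of large numbers. -/
theorem exists_eventually_le_measureReal (hq : 0 < q)
    (hZ : ∀ i, Measurable (Z i)) (hind : iIndepFun Z P) (hμ : ∀ i, P.map (Z i) = μ)
    (hI : ∀ j, Integrable (fun z => absPow T q z j) μ)
    {κ R : ℝ} (hκ : 0 < κ)
    (hlow : ∀ w, κ * Real.exp (-(‖w‖ ^ 2 / 2)) ≤ μ.real {z | ‖T z - T w‖ ≤ R})
    {t : Fin k → ℝ} (ht : ∀ j, 0 < t j) {w : Fin k → EuclideanSpace ℝ (Fin k)}
    (hw : ∀ j, t j ≤ ∑ r, absPow T q (w r) j) {c : ℝ} (hc : 1 < c) :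
    ∃ C > 0, ∀ᶠ N : ℕ in atTop,
      C * Real.exp (-((N : ℝ) ^ (2 / q) * (c ^ 2 * ∑ r, ‖w r‖ ^ 2 / 2))) ≤
      P.real {ω | ∀ j, t j ≤ (1 / (N : ℝ)) * ∑ i ∈ Finset.range N,
        (absPow T q (Z i ω) j - ∫ z, absPow T q z j ∂μ)} := by
  set m : Fin k → ℝ := fun j => ∫ z, absPow T q z j ∂μ with hm
  have hc0 : 0 < c := by linarith
  have hcq : 1 < c ^ q := Real.one_lt_rpow hc hq
  set a : Fin k → ℝ := fun j => (c ^ q - 1) * t j / 2 with ha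
  have ha0 : ∀ j, 0 < a j := fun j => by
    have := mul_pos (sub_pos.2 hcq) (ht j)
    simp only [ha]; linarith
  -- `ψ N r j` is a lower bound for the effect, divided by `N`, of the `r`-th jump
  set ψ : ℕ → Fin k → Fin k → ℝ := fun N r j =>
    (max (c * |T (w r) j| - R * ((N : ℝ) ^ (1 / q))⁻¹) 0) ^ q with hψ
  have hinv : Tendsto (fun N : ℕ => ((N : ℝ) ^ (1 / q))⁻¹) atTop (𝓝 0) :=
    tendsto_inv_atTop_zero.comp (tendsto_natCast_rpow_atTop (by positivity))
  have hψlim : ∀ r j, Tendsto (fun N => ψ N r j) atTop (𝓝 (c ^ q * absPow T q (w r) j)) := by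
    intro r j
    have h1 : Tendsto (fun N : ℕ => max (c * |T (w r) j| - R * ((N : ℝ) ^ (1 / q))⁻¹) 0) atTop
        (𝓝 (max (c * |T (w r) j| - R * 0) 0)) :=
      (tendsto_const_nhds.sub (hinv.const_mul R)).max tendsto_const_nhds
    have h2 := h1.rpow_const (p := q) (Or.inr hq.le)
    have h3 : 0 ≤ c * |T (w r) j| := by positivity
    rw [mul_zero, sub_zero, max_eq_left h3, Real.mul_rpow hc0.le (abs_nonneg _)] at h2
    exact h2
  have hev : ∀ j, ∀ᶠ N : ℕ in atTop, t j ≤ ∑ r, ψ N r j - k * m j / N - a j := by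
    intro j
    have h1 : Tendsto (fun N : ℕ => ∑ r, ψ N r j - k * m j / N - a j) atTop
        (𝓝 (∑ r, c ^ q * absPow T q (w r) j - 0 - a j)) :=
      ((tendsto_finsetSum _ fun r _ => hψlim r j).sub
        (tendsto_const_div_atTop_nhds_zero_nat _)).sub tendsto_const_nhds
    refine h1.eventually (eventually_ge_nhds ?_)
    rw [← Finset.mul_sum]
    have h2 := mul_le_mul_of_nonneg_left (hw j) (by linarith : (0 : ℝ) ≤ c ^ q)
    have h3 := ha0 j
    simp only [ha] at h3 ⊢
    nlinarith
  refine ⟨κ ^ k / 2, by positivity, ?_⟩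
  filter_upwards [eventually_half_le_measureReal_tail hq hZ hind hμ hI k ha0, eventually_all.2 hev,
    eventually_ge_atTop k, eventually_ge_atTop 1] with N hN1 hN2 hNk hN0
  have hNpos : (0 : ℝ) < N := by exact_mod_cast hN0
  set lam : ℝ := (N : ℝ) ^ (1 / q) with hlam
  have hlam0 : 0 < lam := Real.rpow_pos_of_pos hNpos _
  have hlamq : lam ^ q = N := by
    rw [hlam, ← Real.rpow_mul hNpos.le, one_div_mul_cancel hq.ne', Real.rpow_one]
  have hlam2 : lam ^ 2 = (N : ℝ) ^ (2 / q) := by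
    rw [hlam, ← Real.rpow_natCast, ← Real.rpow_mul hNpos.le]
    congr 1; push_cast; ring
  -- the jumps, indexed by the natural numbers
  set v : ℕ → EuclideanSpace ℝ (Fin k) := fun i => if h : i < k then w ⟨i, h⟩ else 0 with hv
  have hvw : ∀ r : Fin k, v r = w r := fun r => by simp [hv]
  set U : ℕ → Set (EuclideanSpace ℝ (Fin k)) := fun i =>
    {z | ‖T z - T ((lam * c) • v i)‖ ≤ R} with hU
  have hUm : ∀ i, MeasurableSet (U i) := fun i =>
    measurableSet_le (by fun_prop) measurable_const
  set A : Set Ω := ⋂ i ∈ Finset.range k, Z i ⁻¹' U i with hA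
  set B : Set Ω := {ω | ∀ j, -(N * a j) ≤
      ∑ i ∈ Finset.Ico k N, (absPow T q (Z i ω) j - m j)} with hB
  have hAB : P (A ∩ B) = P A * P B := by
    have hi := hind.indepFun_finset (Finset.range k) (Finset.Ico k N)
      (Finset.disjoint_left.2 fun i h1 h2 => by simp at h1 h2; omega) hZ
    have hA' : A = (fun ω (i : Finset.range k) => Z i ω) ⁻¹' (Set.univ.pi fun i => U i) := by
      ext ω; simp [hA, Set.mem_pi]
    have hB' : B = (fun ω (i : Finset.Ico k N) => Z i ω) ⁻¹'
        (⋂ j, {x | -(N * a j) ≤ ∑ i, (absPow T q (x i) j - m j)}) := by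
      ext ω
      simp only [hB, Set.mem_ofPred_eq, Set.mem_preimage, Set.mem_iInter]
      refine forall_congr' fun j => ?_
      rw [Finset.sum_coe_sort (Finset.Ico k N) fun i => absPow T q (Z i ω) j - m j]
    rw [hA', hB']
    refine hi.measure_inter_preimage_eq_mul _ _ (MeasurableSet.univ_pi fun i => hUm i)
      (MeasurableSet.iInter fun j => measurableSet_le measurable_const
        (Finset.measurable_sum _ fun i _ => Measurable.sub_const ?_ _))
    exact (continuous_absPow hq j).measurable.comp (measurable_pi_apply i)
  have hPA : κ ^ k * Real.exp (-((N : ℝ) ^ (2 / q) * (c ^ 2 * ∑ r, ‖w r‖ ^ 2 / 2))) ≤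
      P.real A := by
    have h1 : P.real A = ∏ r : Fin k, μ.real (U r) := by
      rw [measureReal_def, hA, hind.measure_inter_preimage_eq_mul _ fun i _ => hUm i,
        ENNReal.toReal_prod, Finset.prod_range]
      refine Finset.prod_congr rfl fun r _ => ?_
      rw [← hμ r, measureReal_def, Measure.map_apply (hZ _) (hUm _)]
    have h2 : ∏ r : Fin k, κ * Real.exp (-(‖(lam * c) • w r‖ ^ 2 / 2)) ≤ P.real A := by
      rw [h1]
      refine Finset.prod_le_prod (fun r _ => by positivity) fun r _ => ?_
      rw [← hvw r]
      exact hlow _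
    refine le_trans (le_of_eq ?_) h2
    rw [Finset.prod_mul_distrib, ← Real.exp_sum]
    simp only [Finset.prod_const, Finset.card_univ, Fintype.card_fin]
    congr 2
    rw [← hlam2, Finset.mul_sum, Finset.mul_sum, ← Finset.sum_neg_distrib]
    refine Finset.sum_congr rfl fun r _ => ?_
    rw [norm_smul, mul_pow, Real.norm_eq_abs, sq_abs]
    ring
  have hsub : A ∩ B ⊆ {ω | ∀ j, t j ≤ (1 / (N : ℝ)) * ∑ i ∈ Finset.range N,
      (absPow T q (Z i ω) j - m j)} := by
    rintro ω ⟨hωA, hωB⟩ j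
    have hωB' := hωB j
    rw [one_div, inv_mul_eq_div, le_div_iff₀ hNpos, ← Finset.sum_range_add_sum_Ico _ hNk,
      Finset.sum_sub_distrib, Finset.sum_range]
    simp only [Finset.sum_const, Finset.card_range, nsmul_eq_mul]
    have h1 : ∀ r : Fin k, N * ψ N r j ≤ absPow T q (Z r ω) j := fun r => by
      have hr : ‖T (Z r ω) - T ((lam * c) • v r)‖ ≤ R := by
        have := Set.mem_iInter₂.1 hωA r (by simp)
        exact this
      have h2 : |T (Z r ω) j - lam * c * T (w r) j| ≤ R := by
        refine le_trans ?_ hr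
        rw [hvw, map_smul]
        exact PiLp.norm_apply_le (T (Z r ω) - (lam * c) • T (w r)) j
      have h3 : lam * (c * |T (w r) j| - R * lam⁻¹) ≤ |T (Z r ω) j| := by
        have h4 : |lam * c * T (w r) j| = lam * (c * |T (w r) j|) := by
          rw [abs_mul, abs_of_pos (mul_pos hlam0 hc0)]; ring
        have h5 := abs_sub_abs_le_abs_sub (lam * c * T (w r) j) (T (Z r ω) j)
        rw [abs_sub_comm, h4] at h5
        have h6 : lam * (R * lam⁻¹) = R := by field_simp
        rw [mul_sub, h6]
        linarith
      have h7 : lam * max (c * |T (w r) j| - R * lam⁻¹) 0 ≤ |T (Z r ω) j| := by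
        rcases max_cases (c * |T (w r) j| - R * lam⁻¹) 0 with h | h
        · rw [h.1]; exact h3
        · rw [h.1, mul_zero]; exact abs_nonneg _
      calc N * ψ N r j = (lam * max (c * |T (w r) j| - R * lam⁻¹) 0) ^ q := by
            rw [Real.mul_rpow hlam0.le (le_max_right _ _), hlamq]
        _ ≤ _ := Real.rpow_le_rpow (mul_nonneg hlam0.le (le_max_right _ _)) h7 hq.le
    have h8 : N * ∑ r, ψ N r j ≤ ∑ r : Fin k, absPow T q (Z r ω) j := by
      rw [Finset.mul_sum]; exact Finset.sum_le_sum fun r _ => h1 r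
    have h9 := mul_le_mul_of_nonneg_left (hN2 j) hNpos.le
    have h10 : N * (∑ r, ψ N r j - k * m j / N - a j) =
        N * ∑ r, ψ N r j - k * m j - N * a j := by field_simp
    rw [h10] at h9
    linarith
  refine le_trans ?_ (measureReal_mono hsub)
  rw [measureReal_def, hAB, ENNReal.toReal_mul, ← measureReal_def, ← measureReal_def]
  calc κ ^ k / 2 * Real.exp (-((N : ℝ) ^ (2 / q) * (c ^ 2 * ∑ r, ‖w r‖ ^ 2 / 2)))
      = κ ^ k * Real.exp (-((N : ℝ) ^ (2 / q) * (c ^ 2 * ∑ r, ‖w r‖ ^ 2 / 2))) * (1 / 2) := by ring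
    _ ≤ _ := by gcongr

end Lower

/-! ### The limit -/

section Limit

variable {Ω : Type*} [MeasurableSpace Ω] {P : Measure Ω} [IsProbabilityMeasure P]
  {k : ℕ} {Z : ℕ → Ω → EuclideanSpace ℝ (Fin k)} {μ : Measure (EuclideanSpace ℝ (Fin k))}
  {T : EuclideanSpace ℝ (Fin k) →L[ℝ] EuclideanSpace ℝ (Fin k)} {q : ℝ}

theorem log_measure_eq_of_pos {s : Set Ω} (h : 0 < P.real s) :
    ENNReal.log (P s) = (Real.log (P.real s) : EReal) := by
  rw [← ENNReal.log_ofReal_of_pos h, ofReal_measureReal]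

/-- The limit for i.i.d. vectors `Z_i` with the two properties of the Gaussian law that matter:
exponential moments of `‖z‖²` of every order below `1 / 2`, and enough mass near every `w`, as seen
through `T`. -/
theorem tendsto_log_measure (hq : 2 < q) [IsProbabilityMeasure μ]
    (hZ : ∀ i, Measurable (Z i)) (hind : iIndepFun Z P) (hμ : ∀ i, P.map (Z i) = μ)
    (hexp : ∀ c < (1 / 2 : ℝ), Integrable (fun z => Real.exp (c * ‖z‖ ^ 2)) μ)
    {κ R : ℝ} (hκ : 0 < κ)
    (hlow : ∀ w, κ * Real.exp (-(‖w‖ ^ 2 / 2)) ≤ μ.real {z | ‖T z - T w‖ ≤ R})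
    {t : Fin k → ℝ} (ht : ∀ j, 0 < t j) :
    Tendsto (fun N : ℕ => ((1 / (N : ℝ) ^ (2 / q) : ℝ) : EReal) *
      ENNReal.log (P {ω | ∀ j, t j ≤ (1 / (N : ℝ)) * ∑ i ∈ Finset.range N,
        (absPow T q (Z i ω) j - ∫ z, absPow T q z j ∂μ)}))
      atTop (𝓝 (-((jumpRate T q t : ℝ≥0∞) : EReal))) := by
  have hq0 : 0 < q := by linarith
  refine tendsto_order.2 ⟨fun x hx => ?_, fun x hx => ?_⟩
  · have hfin : jumpRate T q t ≠ ⊤ := by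
      rintro h
      rw [h, EReal.coe_ennreal_top, EReal.neg_top] at hx
      exact not_lt_bot hx
    obtain ⟨w, hw, he⟩ := exists_eq_jumpRate hq hfin
    set s := ∑ r, ‖w r‖ ^ 2 / 2 with hs
    have hs0 : 0 ≤ s := Finset.sum_nonneg fun r _ => by positivity
    rw [he, EReal.coe_ennreal_ofReal, max_eq_left hs0, ← EReal.coe_neg] at hx
    obtain ⟨y, hxy, hys⟩ := EReal.lt_iff_exists_real_btwn.1 hx
    rw [EReal.coe_lt_coe_iff] at hys
    obtain ⟨c, hcs, hc⟩ : ∃ c : ℝ, c ^ 2 * s < -y ∧ 1 < c := by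
      have h1 : Tendsto (fun c : ℝ => c ^ 2 * s) (𝓝[>] 1) (𝓝 (1 ^ 2 * s)) :=
        (Continuous.tendsto (by fun_prop) 1).mono_left nhdsWithin_le_nhds
      exact ((h1.eventually (eventually_lt_nhds (by linarith))).and self_mem_nhdsWithin).exists
    obtain ⟨C, hC, hev⟩ := exists_eventually_le_measureReal hq0 hZ hind hμ
      (fun j => integrable_absPow hq hexp j) hκ hlow ht hw hc
    have hlim : Tendsto (fun N : ℕ => 1 / (N : ℝ) ^ (2 / q) * Real.log C - c ^ 2 * s) atTop
        (𝓝 (0 * Real.log C - c ^ 2 * s)) := by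
      refine Tendsto.sub_const (Tendsto.mul_const _ ?_) _
      simpa only [one_div, Function.comp_def] using tendsto_inv_atTop_zero.comp
        (tendsto_natCast_rpow_atTop (p := 2 / q) (by positivity))
    filter_upwards [hev, hlim.eventually (eventually_gt_nhds (by linarith : y < _)),
      eventually_ge_atTop 1] with N h1 h2 hN
    have hNp : (0 : ℝ) < (N : ℝ) ^ (2 / q) := Real.rpow_pos_of_pos (by exact_mod_cast hN) _
    refine hxy.trans_le ?_
    rw [log_measure_eq_of_pos ((by positivity : (0 : ℝ) < _).trans_le h1), ← EReal.coe_mul,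
      EReal.coe_le_coe_iff]
    have h3 := Real.log_le_log (by positivity) h1
    rw [Real.log_mul hC.ne' (Real.exp_pos _).ne', Real.log_exp] at h3
    refine h2.le.trans (le_trans (le_of_eq ?_) (mul_le_mul_of_nonneg_left h3 (by positivity)))
    field_simp
    ring
  · obtain ⟨y, hIy, hyx⟩ := EReal.lt_iff_exists_real_btwn.1 hx
    refine Eventually.mono ?_ fun N hN => lt_of_le_of_lt hN hyx
    rcases le_or_gt 0 y with hy | hy
    · refine Eventually.of_forall fun N => ?_
      have h1 : ENNReal.log (P {ω | ∀ j, t j ≤ (1 / (N : ℝ)) * ∑ i ∈ Finset.range N,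
        (absPow T q (Z i ω) j - ∫ z, absPow T q z j ∂μ)}) ≤ 0 :=
          ENNReal.log_le_zero_iff.2 prob_le_one
      refine (mul_nonpos_of_nonneg_of_nonpos ?_ h1).trans (by exact_mod_cast hy)
      exact_mod_cast (by positivity : (0 : ℝ) ≤ 1 / (N : ℝ) ^ (2 / q))
    · have h1 : ((-y : ℝ) : EReal) < (jumpRate T q t : EReal) := by
        rw [EReal.coe_neg]; exact EReal.neg_lt_comm.1 hIy
      obtain ⟨l, hyl, hl⟩ := EReal.lt_iff_exists_real_btwn.1 h1
      rw [EReal.coe_lt_coe_iff] at hyl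
      have hl' : ENNReal.ofReal l ≤ jumpRate T q t := by
        rw [← EReal.coe_ennreal_le_coe_ennreal_iff, EReal.coe_ennreal_ofReal,
          max_eq_left (by linarith)]
        exact hl.le
      filter_upwards [eventually_measureReal_le_exp hq hZ hind hμ hexp ht hl' (by linarith) hyl,
        eventually_ge_atTop 1] with N h2 hN
      have hNp : (0 : ℝ) < (N : ℝ) ^ (2 / q) := Real.rpow_pos_of_pos (by exact_mod_cast hN) _
      have h3 : ENNReal.log (P {ω | ∀ j, t j ≤ (1 / (N : ℝ)) * ∑ i ∈ Finset.range N,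
          (absPow T q (Z i ω) j - ∫ z, absPow T q z j ∂μ)}) ≤
          (((N : ℝ) ^ (2 / q) * y : ℝ) : EReal) := by
        rw [← Real.log_exp ((N : ℝ) ^ (2 / q) * y), ← ENNReal.log_ofReal_of_pos (Real.exp_pos _)]
        refine ENNReal.log_monotone ?_
        rw [← ofReal_measureReal]
        refine ENNReal.ofReal_le_ofReal (h2.trans (le_of_eq ?_))
        congr 1; ring
      refine (mul_le_mul_of_nonneg_left h3 ?_).trans (le_of_eq ?_)
      · exact_mod_cast (by positivity : (0 : ℝ) ≤ 1 / (N : ℝ) ^ (2 / q))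
      · rw [← EReal.coe_mul]
        congr 1
        field_simp

end Limit

/-! ### Gaussian measures -/

section Gaussian

theorem absMoment_eq {q : ℝ} (hq : -1 < q) :
    absMoment q = 2 ^ (q / 2) * Real.Gamma ((q + 1) / 2) / Real.sqrt Real.pi := by
  rw [absMoment, integral_gaussianReal_eq_integral_smul one_ne_zero]
  have h1 : ∀ x : ℝ, gaussianPDFReal 0 1 x • |x| ^ q =
      (fun y : ℝ => (√(2 * Real.pi))⁻¹ * (y ^ q * Real.exp (-(1 / 2) * y ^ (2 : ℝ)))) |x| := by
    intro x
    simp only [gaussianPDFReal_def, smul_eq_mul, sub_zero, NNReal.coe_one, mul_one, Real.rpow_two,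
      sq_abs]
    rw [show -x ^ 2 / 2 = -(1 / 2) * x ^ 2 by ring]
    ring
  simp_rw [h1]
  rw [integral_comp_abs (f := fun y : ℝ =>
    (√(2 * Real.pi))⁻¹ * (y ^ q * Real.exp (-(1 / 2) * y ^ (2 : ℝ)))), integral_const_mul,
    integral_rpow_mul_exp_neg_mul_rpow two_pos hq (by norm_num)]
  have h2 : ((1 / 2 : ℝ)) ^ (-(q + 1) / 2) = 2 ^ (q / 2) * √2 := by
    rw [one_div, Real.inv_rpow zero_le_two, ← Real.rpow_neg zero_le_two, Real.sqrt_eq_rpow,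
      ← Real.rpow_add two_pos]
    congr 1; ring
  rw [h2, Real.sqrt_mul zero_le_two]
  field_simp

theorem integral_abs_rpow_gaussianReal {q : ℝ} {v : ℝ} (hv : 0 ≤ v) :
    ∫ x, |x| ^ q ∂(gaussianReal 0 v.toNNReal) = v ^ (q / 2) * absMoment q := by
  have h : gaussianReal 0 v.toNNReal = (gaussianReal 0 1).map (√v * ·) := by
    rw [gaussianReal_map_const_mul, mul_zero]
    congr 1
    ext
    simp [Real.sq_sqrt hv, hv]
  rw [h, integral_map (by fun_prop) (by
    exact (measurable_norm.pow_const q).aestronglyMeasurable), absMoment, ← integral_const_mul]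
  refine integral_congr_ae (ae_of_all _ fun x => ?_)
  simp only
  rw [abs_mul, Real.mul_rpow (abs_nonneg _) (abs_nonneg _), abs_of_nonneg (Real.sqrt_nonneg v),
    Real.sqrt_eq_rpow, ← Real.rpow_mul hv]
  congr 2; ring

theorem integrable_exp_mul_sq_gaussianReal {c : ℝ} (hc : c < 1 / 2) :
    Integrable (fun x : ℝ => Real.exp (c * x ^ 2)) (gaussianReal 0 1) := by
  rw [gaussianReal_of_var_ne_zero _ one_ne_zero, integrable_withDensity_iff_integrable_smul'
    (measurable_gaussianPDF 0 1) (ae_of_all _ fun _ => gaussianPDF_lt_top)]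
  refine ((integrable_exp_neg_mul_sq (sub_pos.2 hc)).const_mul (√(2 * Real.pi))⁻¹).congr
    (ae_of_all _ fun x => ?_)
  simp only [toReal_gaussianPDF, gaussianPDFReal_def, smul_eq_mul, sub_zero, NNReal.coe_one,
    mul_one]
  rw [mul_assoc, ← Real.exp_add]
  congr 2; ring

/-- The Gaussian density is at least `(2 π e)^{-1/2} e^{-a² / 2}` on an interval of length one with
endpoint `a`, the one on the side of the origin. -/
theorem le_gaussianReal_Icc (a : ℝ) :
    (√(2 * Real.pi))⁻¹ * Real.exp (-(1 / 2)) * Real.exp (-(a ^ 2 / 2)) ≤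
      (gaussianReal 0 1).real (Set.Icc (a - 1) (a + 1)) := by
  obtain ⟨b, hb1, hb2, hb⟩ : ∃ b, a - 1 ≤ b ∧ b ≤ a ∧ ∀ x ∈ Set.Icc b (b + 1), x ^ 2 ≤ a ^ 2 + 1 := by
    rcases le_total 0 a with h | h
    · exact ⟨a - 1, le_rfl, by linarith, fun x hx => by nlinarith [hx.1, hx.2]⟩
    · exact ⟨a, by linarith, le_rfl, fun x hx => by nlinarith [hx.1, hx.2]⟩
  refine le_trans ?_ (measureReal_mono (Set.Icc_subset_Icc hb1 (by linarith : b + 1 ≤ a + 1)))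
  rw [measureReal_def, gaussianReal_apply_eq_integral _ one_ne_zero, ENNReal.toReal_ofReal
    (setIntegral_nonneg measurableSet_Icc fun x _ => gaussianPDFReal_nonneg _ _ _)]
  calc _ = ∫ _x in Set.Icc b (b + 1),
        (√(2 * Real.pi))⁻¹ * Real.exp (-(1 / 2)) * Real.exp (-(a ^ 2 / 2)) := by simp
    _ ≤ _ := by
      refine setIntegral_mono_on continuous_const.integrableOn_Icc
        (integrable_gaussianPDFReal _ _).integrableOn
        measurableSet_Icc fun x hx => ?_
      simp only [gaussianPDFReal_def, sub_zero, NNReal.coe_one, mul_one]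
      rw [mul_assoc, ← Real.exp_add]
      gcongr
      linarith [hb x hx]

variable {k : ℕ}

theorem integrable_exp_mul_norm_sq_stdGaussian {c : ℝ} (hc : c < 1 / 2) :
    Integrable (fun z => Real.exp (c * ‖z‖ ^ 2)) (stdGaussian (EuclideanSpace ℝ (Fin k))) := by
  rw [← map_pi_eq_stdGaussian, integrable_map_measure (by fun_prop) (by fun_prop)]
  have h := Integrable.fintype_prod (μ := fun _ : Fin k => gaussianReal 0 1)
    (f := fun _ x => Real.exp (c * x ^ 2)) fun _ => integrable_exp_mul_sq_gaussianReal hc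
  refine h.congr (ae_of_all _ fun x => ?_)
  simp [EuclideanSpace.real_norm_sq_eq, Finset.mul_sum, Real.exp_sum]

theorem exists_le_stdGaussian_closedBall :
    ∃ κ > 0, ∀ w : EuclideanSpace ℝ (Fin k), κ * Real.exp (-(‖w‖ ^ 2 / 2)) ≤
      (stdGaussian (EuclideanSpace ℝ (Fin k))).real {z | ‖z - w‖ ≤ √k} := by
  refine ⟨((√(2 * Real.pi))⁻¹ * Real.exp (-(1 / 2))) ^ k, by positivity, fun w => ?_⟩
  rw [← map_pi_eq_stdGaussian, map_measureReal_apply (by fun_prop)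
    (measurableSet_le (by fun_prop) measurable_const)]
  have hsub : (Set.univ.pi fun j => Set.Icc (w j - 1) (w j + 1)) ⊆
      (WithLp.toLp 2) ⁻¹' {z : EuclideanSpace ℝ (Fin k) | ‖z - w‖ ≤ √k} := by
    intro x hx
    simp only [Set.mem_preimage, Set.mem_ofPred_eq]
    refine Real.le_sqrt_of_sq_le ?_
    rw [EuclideanSpace.real_norm_sq_eq]
    calc _ ≤ ∑ _j : Fin k, (1 : ℝ) := Finset.sum_le_sum fun j _ => by
          have := hx j (Set.mem_univ j)
          simp only [PiLp.sub_apply]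
          nlinarith [this.1, this.2]
      _ = k := by simp
  refine le_trans ?_ (measureReal_mono hsub)
  rw [measureReal_def, Measure.pi_pi, ENNReal.toReal_prod]
  calc _ = ∏ j, (√(2 * Real.pi))⁻¹ * Real.exp (-(1 / 2)) * Real.exp (-(w j ^ 2 / 2)) := by
        rw [Finset.prod_mul_distrib, ← Real.exp_sum, EuclideanSpace.real_norm_sq_eq,
          Finset.sum_neg_distrib, Finset.sum_div]
        simp
    _ ≤ _ := Finset.prod_le_prod (fun j _ => by positivity) fun j _ => le_gaussianReal_Icc _

end Gaussian

end AbsPowersGauss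

/-! ### Gaussian vectors with covariance `S` -/

theorem theorem3p3 {Ω : Type*} [MeasurableSpace Ω] (P : Measure Ω) [IsProbabilityMeasure P]
    (k : ℕ) (S : Matrix (Fin k) (Fin k) ℝ) (hS : S.PosSemidef) (q : ℝ) (hq : 2 < q)
    (G : ℕ → Ω → EuclideanSpace ℝ (Fin k)) (hindep : iIndepFun G P)
    (hlaw : ∀ i, HasLaw (G i) (multivariateGaussian 0 S) P) :
    absMoment q = 2 ^ (q / 2) * Real.Gamma ((q + 1) / 2) / Real.sqrt Real.pi ∧
    ∀ t : Fin k → ℝ, (∀ j, 0 < t j) →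
      IsLeast (decompositionCosts (tailRate S q) t) (rateI (tailRate S q) t) ∧
      Tendsto
        (fun N : ℕ => ((1 / (N : ℝ) ^ (2 / q) : ℝ) : EReal) *
          ENNReal.log (P {ω | ∀ j, t j ≤
            (1 / (N : ℝ)) * ∑ i ∈ Finset.range N, centeredPower S q (G i ω) j}))
        atTop (𝓝 (-((rateI (tailRate S q) t : ℝ≥0∞) : EReal))) := by
  refine ⟨absMoment_eq (by linarith), fun t ht => ?_⟩
  have hq0 : 0 < q := by linarith
  open scoped MatrixOrder in
  obtain ⟨A, hA, hAS, hlawA⟩ : ∃ A : Matrix (Fin k) (Fin k) ℝ, Aᵀ = A ∧ A * A = S ∧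
      multivariateGaussian 0 S = (stdGaussian (EuclideanSpace ℝ (Fin k))).map
        (toEuclideanCLM (𝕜 := ℝ) A) := by
    refine ⟨CFC.sqrt S, ?_, CFC.sqrt_mul_sqrt_self S hS.nonneg, ?_⟩
    · have h := (CFC.sqrt_nonneg S).isSelfAdjoint.star_eq
      rwa [Matrix.star_eq_conjTranspose, Matrix.conjTranspose_eq_transpose_of_trivial] at h
    · simp [multivariateGaussian]
  have hH := hS.isHermitian
  rw [rateI_eq_jumpRate hS hA hAS hq ht]
  refine ⟨isLeast_jumpRate hS hA hAS hq ht, ?_⟩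
  set ν := stdGaussian (EuclideanSpace ℝ (Fin k)) with hν
  set T := toEuclideanCLM (𝕜 := ℝ) A with hT
  -- `W` inverts `T` on its range, and `W ∘ T` is the orthogonal projection `E`
  set W := toEuclideanCLM (𝕜 := ℝ) (A * pinv S) with hW
  set E := toEuclideanCLM (𝕜 := ℝ) (A * pinv S * A) with hE
  have hWT : ∀ z, W (T z) = E z := fun z => by
    rw [hE, map_mul]; rfl
  have hTE : ∀ z, T (E z) = T z := fun z => by
    have : A * (A * pinv S * A) = A := by
      rw [← Matrix.mul_assoc, ← Matrix.mul_assoc, hAS, mul_pinv_mul_sqrt hH hA hAS]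
    calc T (E z) = toEuclideanCLM (𝕜 := ℝ) (A * (A * pinv S * A)) z := by rw [map_mul]; rfl
      _ = T z := by rw [this]
  have hEn : ∀ z, ‖E z‖ ≤ ‖z‖ := norm_toEuclideanCLM_projection_le hH hA hAS
  set μ := ν.map E with hμdef
  have : IsProbabilityMeasure μ := Measure.isProbabilityMeasure_map (by fun_prop)
  have hexp : ∀ c < (1 / 2 : ℝ), Integrable (fun z => Real.exp (c * ‖z‖ ^ 2)) μ := by
    intro c hc
    rw [hμdef, integrable_map_measure (by fun_prop) (by fun_prop)]
    refine (integrable_exp_mul_norm_sq_stdGaussian (c := max c 0) (max_lt hc (by norm_num))).mono'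
      (by fun_prop) (ae_of_all _ fun z => ?_)
    rw [Function.comp_apply, Real.norm_of_nonneg (Real.exp_pos _).le]
    refine Real.exp_le_exp.2 ?_
    calc c * ‖E z‖ ^ 2 ≤ max c 0 * ‖E z‖ ^ 2 := by gcongr; exact le_max_left _ _
      _ ≤ max c 0 * ‖z‖ ^ 2 := by gcongr; exact hEn z
  obtain ⟨κ, hκ, hball⟩ := exists_le_stdGaussian_closedBall (k := k)
  have hlow : ∀ w, κ * Real.exp (-(‖w‖ ^ 2 / 2)) ≤ μ.real {z | ‖T z - T w‖ ≤ ‖T‖ * √k} := by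
    intro w
    rw [hμdef, map_measureReal_apply (by fun_prop)
      (measurableSet_le (by fun_prop) measurable_const)]
    refine (hball w).trans (measureReal_mono fun z hz => ?_)
    simp only [Set.mem_preimage, Set.mem_ofPred_eq] at hz ⊢
    rw [hTE, ← map_sub]
    exact (T.le_opNorm _).trans (mul_le_mul_of_nonneg_left hz (norm_nonneg _))
  -- measurable versions of the Gaussian vectors
  set G' : ℕ → Ω → EuclideanSpace ℝ (Fin k) := fun i => (hlaw i).aemeasurable.mk (G i) with hG'
  have hG'm : ∀ i, Measurable (G' i) := fun i => (hlaw i).aemeasurable.measurable_mk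
  have hG'ae : ∀ i, G i =ᵐ[P] G' i := fun i => (hlaw i).aemeasurable.ae_eq_mk
  have hG'map : ∀ i, P.map (G' i) = ν.map T := fun i => by
    rw [← Measure.map_congr (hG'ae i), (hlaw i).map_eq, hlawA]
  have hrange : ∀ᵐ g ∂(ν.map T), T (W g) = g := by
    refine (ae_map_iff T.measurable.aemeasurable (measurableSet_eq_fun
      (T.measurable.comp W.measurable) measurable_id)).2 ?_
    exact ae_of_all _ fun z => by simp only [Function.comp_apply, hWT, hTE, id]
  set Z : ℕ → Ω → EuclideanSpace ℝ (Fin k) := fun i ω => W (G' i ω) with hZdef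
  have hZ : ∀ i, Measurable (Z i) := fun i => W.measurable.comp (hG'm i)
  have hind : iIndepFun Z P := (hindep.congr hG'ae).comp (fun _ => W) fun _ => W.measurable
  have hμ : ∀ i, P.map (Z i) = μ := fun i => by
    calc P.map (Z i) = (P.map (G' i)).map W := (Measure.map_map W.measurable (hG'm i)).symm
      _ = (ν.map T).map W := by rw [hG'map]
      _ = ν.map (W ∘ T) := Measure.map_map W.measurable T.measurable
      _ = μ := by rw [hμdef]; congr 1; funext z; exact hWT z
  have hTZ : ∀ᵐ ω ∂P, ∀ i, T (Z i ω) = G i ω := by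
    refine ae_all_iff.2 fun i => ?_
    have h := ae_of_ae_map (hG'm i).aemeasurable ((hG'map i).symm ▸ hrange)
    filter_upwards [h, hG'ae i] with ω h1 h2
    rw [h2]; exact h1
  have hmean : ∀ j, ∫ z, absPow T q z j ∂μ = S j j ^ (q / 2) * absMoment q := by
    intro j
    have hm : Measurable fun x : ℝ => |x| ^ q := measurable_norm.pow_const q
    rw [hμdef, integral_map (by fun_prop) (continuous_absPow hq0 j).aestronglyMeasurable]
    simp only [absPow, hTE]
    have h1 : Measurable fun g : EuclideanSpace ℝ (Fin k) => |g j| ^ q := hm.comp (by fun_prop)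
    calc ∫ z, |T z j| ^ q ∂ν = ∫ g, |g j| ^ q ∂(multivariateGaussian 0 S) := by
          rw [hlawA, integral_map (by fun_prop) h1.aestronglyMeasurable]
      _ = ∫ x, |x| ^ q ∂(gaussianReal 0 (S j j).toNNReal) := by
          have h2 := measurePreserving_eval_multivariateGaussian (μ := 0) hS (i := j)
          have h3 := h2.map_eq
          rw [PiLp.zero_apply] at h3
          rw [← h3, integral_map h2.measurable.aemeasurable hm.aestronglyMeasurable]
      _ = _ := integral_abs_rpow_gaussianReal hS.diag_nonneg
  refine (tendsto_log_measure (T := T) hq hZ hind hμ hexp hκ hlow ht).congr fun N => ?_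
  congr 2
  refine measure_congr (hTZ.mono fun ω hω => ?_)
  refine propext (forall_congr' fun j => ?_)
  simp only [hmean]
  simp only [absPow, hω, centeredPower]
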